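/- Fix $d\in\mathbb N$. Let $\mathcal D$ be the set of density matrices on $\mathbb C^d$ (positive semidefinite, trace $1$), and call completely positive trace-preserving linear maps on the $d\times d$ complex matrices channels. **Functions $f$.** Let $f:(0,\infty)\to[0,\infty)$ be convex and twice continuously differentiable with $f(1)=f'(1)=0$. For probability vectors $p,q$ with strictly positive entries put $D_f(p\|q)=\sum_i q_i f(p_i/q_i)$. We write $f\in\mathcal F_{\mathrm{Pin}}$ if, moreover, for every dimension there is a constant $C>0$ with $D_f(p\|q)\ge C\,\|p-q\|_1^2$ for all such $p,q$ of that dimension. A quantum $f$-divergence is a map $\mathbb D_f:\mathcal D\times\mathcal D\to[0,\infty]$ such that $\mathbb D_f(\mathcal E(\rho)\|\mathcal E(\sigma))\le\mathbb D_f(\rho\|\sigma)$ for all states $\rho,\sigma$ and all channels $\mathcal E$, and $\mathbb D_f(U\,\mathrm{diag}(p)\,U^*\,\|\,U\,\mathrm{diag}(q)\,U^*)=D_f(p\|q)$ for every unitary $U$ and all strictly positive probability vectors $p,q$. **Functions $g$.** A function $g:(0,\infty)\to\mathbb R$ is standard monotone if it is operator monotone decreasing ($0<A\le B$ implies $g(A)\ge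 g(B)$, for matrices of any size), $g(1)=1$, and $g(x^{-1})=x\,g(x)$ for all $x>0$. For a full-rank state $\sigma$ let $\Delta_\sigma(X)=\sigma X\sigma^{-1}$ and $\Omega_\sigma^g(X)=\big(g(\Delta_\sigma)(X)\big)\sigma^{-1}$, where $g(\Delta_\sigma)$ is the functional calculus with respect to the Hilbert–Schmidt inner product $\langle X,Y\rangle=\mathrm{Tr}[X^*Y]$; put $\chi^2_g(\rho\|\sigma)=\langle\rho-\sigma,\Omega_\sigma^g(\rho-\sigma)\rangle$. **SDPI constants.** For $\mathbb D=\mathbb D_f$ or $\mathbb D=\chi^2_g$ let $$\eta_{\mathbb D}(\mathcal E,\sigma)=\sup_{\rho\in\mathcal D,\;0<\mathbb D(\rho\|\sigma)<\infty}\frac{\mathbb D(\mathcal E(\rho)\|\mathcal E(\sigma))}{\mathbb D(\rho\|\sigma)}\qquad(\sup\emptyset=0).$$ **Theorem.** Let $f\in\mathcal F_{\mathrm{Pin}}$ be thrice continuously differentiable in a neighbourhood of $1$, let $g$ be standard monotone, and let $\mathbb D_f$ be a quantum $f$-divergence. Let $\mathcal E$ be a primitive channel (for some $n$, $\mathcal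 E^{\circ n}(\rho)>0$ for all $\rho\in\mathcal D$) with a full-rank state $\pi$ such that $\mathcal E(\pi)=\pi$. Then the limit below exists and $$\lim_{n\to\infty}\eta_{\mathbb D_f}(\mathcal E^{\circ n},\pi)^{1/n}\;\le\;\eta_{\chi^2_g}(\mathcal E,\pi).$$ Equality holds if, moreover, $\mathbb D_f$ is locally $\chi^2_g$, i.e. $\lim_{\lambda\downarrow0}\lambda^{-2}\,\mathbb D_f(\lambda\rho+(1-\lambda)\sigma\,\|\,\sigma)=\tfrac{f''(1)}2\chi^2_g(\rho\|\sigma)$ for all full-rank states $\rho,\sigma$, and $\mathcal E$ satisfies $g$-detailed balance with respect to $\pi$, i.e. $(\Omega_\pi^g)^{-1}\circ\mathcal E^*=\mathcal E\circ(\Omega_\pi^g)^{-1}$, where $\mathcal E^*$ is the Hilbert–Schmidt adjoint of $\mathcal E$. -/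

import Mathlib

open scoped ENNReal Topology ComplexOrder

noncomputable section

namespace QDiv

/-- Operators on the Hilbert space `ℂ^d`. -/
abbrev Mat (d : ℕ) : Type := Matrix (Fin d) (Fin d) ℂ

/-- Super-operators, i.e. linear maps on the operators on `ℂ^d`. -/
abbrev SuperOp (d : ℕ) : Type := Module.End ℂ (Mat d)

/-! ### States and channels -/

/-- Density matrices. -/
def IsState {d : ℕ} (ρ : Mat d) : Prop :=
  ρ.PosSemidef ∧ ρ.trace = 1

/-- Complete positivity: for every `k`, applying `E` to each block of a positive semidefinite
`k × k` block matrix with blocks in `Mat d` gives a positive semidefinite matrix. -/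
def IsCompletelyPositive {d : ℕ} (E : SuperOp d) : Prop :=
  ∀ (k : ℕ) (X : Matrix (Fin k) (Fin k) (Mat d)),
    (Matrix.comp (Fin k) (Fin k) (Fin d) (Fin d) ℂ X).PosSemidef →
    (Matrix.comp (Fin k) (Fin k) (Fin d) (Fin d) ℂ (X.map E)).PosSemidef

/-- Quantum channels: completely positive, trace-preserving maps. -/
structure IsChannel {d : ℕ} (E : SuperOp d) : Prop where
  completelyPositive : IsCompletelyPositive E
  tracePreserving : ∀ X : Mat d, (E X).trace = X.trace

/-- Primitivity: some iterate of `E` sends every state to a full-rank (positive definite) one.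
(The power `E ^ n` in `Module.End` is the `n`-fold composition of `E` with itself.) -/
def IsPrimitive {d : ℕ} (E : SuperOp d) : Prop :=
  ∃ n : ℕ, ∀ ρ : Mat d, IsState ρ → ((E ^ n) ρ).PosDef

/-! ### The classes of functions `𝓕` and `𝓕_Pin`, and quantum `f`-divergences -/

/-- The class `𝓕`; only the values of `f` on `(0, ∞)` matter. -/
structure MemF (f : ℝ → ℝ) : Prop where
  nonneg : ∀ x : ℝ, 0 < x → 0 ≤ f x
  contDiffOn : ContDiffOn ℝ 2 f (Set.Ioi 0)
  convexOn : ConvexOn ℝ (Set.Ioi 0) f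
  map_one : f 1 = 0
  deriv_one : deriv f 1 = 0

/-- Probability vectors with full support. -/
def IsPosProb {d : ℕ} (p : Fin d → ℝ) : Prop :=
  (∀ i, 0 < p i) ∧ ∑ i, p i = 1

/-- The classical `f`-divergence of probability vectors with full support. -/
def classicalDiv (f : ℝ → ℝ) {d : ℕ} (p q : Fin d → ℝ) : ℝ :=
  ∑ i, q i * f (p i / q i)

/-- The class `𝓕_Pin`: functions in `𝓕` with a Pinsker inequality, whose constant may depend on
`f` and on the dimension. (For vectors with zero entries, with the usual conventions for
`q f(p/q)`, the same inequality follows on mixing both with the uniform vector, as `D_f` is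
jointly convex; so restricting to full support is no restriction.) -/
structure MemFPin (f : ℝ → ℝ) : Prop where
  memF : MemF f
  pinsker : ∀ d : ℕ, ∃ C : ℝ, 0 < C ∧ ∀ p q : Fin d → ℝ, IsPosProb p → IsPosProb q →
    C * (∑ i, |p i - q i|) ^ 2 ≤ classicalDiv f p q

/-- Quantum `f`-divergences on the states on `ℂ^d`: maps with values in `[0, ∞]` that satisfy the
data-processing inequality and agree with the classical `f`-divergence on commuting states, that
is, on states that are diagonal in a common orthonormal basis (the columns of `U`). Agreement is
asked for full-rank states only, so that no convention for singular commuting states is imposed.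
The values of `D` at matrices that are not states play no role. -/
structure IsQuantumFDivergence (f : ℝ → ℝ) {d : ℕ} (D : Mat d → Mat d → ℝ≥0∞) : Prop where
  dataProcessing : ∀ E : SuperOp d, IsChannel E → ∀ ρ σ : Mat d, IsState ρ → IsState σ →
    D (E ρ) (E σ) ≤ D ρ σ
  classicalConsistency : ∀ U ∈ Matrix.unitaryGroup (Fin d) ℂ, ∀ p q : Fin d → ℝ,
    IsPosProb p → IsPosProb q →
    D (U * Matrix.diagonal (fun i => (p i : ℂ)) * star U)
      (U * Matrix.diagonal (fun i => (q i : ℂ)) * star U) = ENNReal.ofReal (classicalDiv f p q)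

/-- The SDPI constant `η_D(E, σ)`: the supremum, over the states `ρ` with `0 < D(ρ‖σ) < ∞`, of
`D(E ρ‖E σ) / D(ρ‖σ)`. It is `0` when there is no such `ρ`. -/
def sdpi {d : ℕ} (D : Mat d → Mat d → ℝ≥0∞) (E : SuperOp d) (σ : Mat d) : ℝ≥0∞ :=
  ⨆ (ρ : Mat d) (_ : IsState ρ) (_ : 0 < D ρ σ) (_ : D ρ σ < ∞), D (E ρ) (E σ) / D ρ σ

/-! ### Standard monotone functions and quantum `χ²`-divergences -/

/-- The class `𝓜_st` of standard monotone functions; only the values of `g` on `(0, ∞)` matter. -/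
structure MemMst (g : ℝ → ℝ) : Prop where
  operatorAntitone : ∀ (k : ℕ) (A B : Mat k), A.PosDef → (B - A).PosSemidef →
    (cfc g A - cfc g B).PosSemidef
  map_one : g 1 = 1
  symmetry : ∀ x : ℝ, 0 < x → g x⁻¹ = x * g x

/-- The orthonormal basis of matrix units for the Hilbert-Schmidt inner product. -/
abbrev unitBasis (d : ℕ) : Module.Basis (Fin d × Fin d) ℂ (Mat d) :=
  Matrix.stdBasis ℂ (Fin d) (Fin d)

/-- Functional calculus for super-operators that are self-adjoint for the Hilbert-Schmidt inner
product. -/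
def superFun {d : ℕ} (g : ℝ → ℝ) (T : SuperOp d) : SuperOp d :=
  Matrix.toLin (unitBasis d) (unitBasis d)
    (cfc g (LinearMap.toMatrix (unitBasis d) (unitBasis d) T))

/-- The adjoint of a super-operator for the Hilbert-Schmidt inner product. -/
def superAdjoint {d : ℕ} (T : SuperOp d) : SuperOp d :=
  Matrix.toLin (unitBasis d) (unitBasis d)
    (LinearMap.toMatrix (unitBasis d) (unitBasis d) T).conjTranspose

/-- The relative modular operator `Δ_{P,Q} = L_P R_{Q⁻¹}`, that is, `X ↦ P X Q⁻¹`. -/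
def modularOp {d : ℕ} (P Q : Mat d) : SuperOp d :=
  LinearMap.mulLeft ℂ P ∘ₗ LinearMap.mulRight ℂ Q⁻¹

/-- The quantum inversion `Ω_σ^g = R_σ⁻¹ g(Δ_{σ,σ})` of a full-rank state `σ`. -/
def inversion {d : ℕ} (g : ℝ → ℝ) (σ : Mat d) : SuperOp d :=
  LinearMap.mulRight ℂ σ⁻¹ ∘ₗ superFun g (modularOp σ σ)

/-- The divergence `χ²_g(ρ‖σ) = ⟨ρ - σ, Ω_σ^g (ρ - σ)⟩` of a state `ρ` and a full-rank state `σ`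
(for these the inner product is a nonnegative real number when `g` is standard monotone). -/
def chiSq {d : ℕ} (g : ℝ → ℝ) (ρ σ : Mat d) : ℝ≥0∞ :=
  ENNReal.ofReal (((ρ - σ).conjTranspose * inversion g σ (ρ - σ)).trace).re

/-- `D` is locally `χ²_g` (for full-rank states `ρ` and `σ`). -/
def IsLocallyChiSq (f : ℝ → ℝ) (g : ℝ → ℝ) {d : ℕ} (D : Mat d → Mat d → ℝ≥0∞) : Prop :=
  ∀ ρ σ : Mat d, IsState ρ → IsState σ → ρ.PosDef → σ.PosDef →
    Filter.Tendsto
      (fun t : ℝ => D ((t : ℂ) • ρ + ((1 - t : ℝ) : ℂ) • σ) σ / ENNReal.ofReal (t ^ 2))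
      (𝓝[>] 0) (𝓝 (ENNReal.ofReal (deriv (deriv f) 1 / 2) * chiSq g ρ σ))

/-- `g`-detailed balance `(Ω_σ^g)⁻¹ ∘ E* = E ∘ (Ω_σ^g)⁻¹` with respect to a full-rank `σ`
(`Ω_σ^g` is then invertible for standard monotone `g`). -/
def DetailedBalance {d : ℕ} (g : ℝ → ℝ) (σ : Mat d) (E : SuperOp d) : Prop :=
  Ring.inverse (inversion g σ) ∘ₗ superAdjoint E = E ∘ₗ Ring.inverse (inversion g σ)

end QDiv

end

/-!
Write `q(X) = ⟨X, Ω_π^g X⟩`, so that `χ²_g(ρ‖π) = q(ρ - π)`. As a product of the commuting positive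
definite operators `R_π⁻¹` and `g(Δ_π)`, the inversion `Ω_π^g` is positive definite
(`posDef_toMatrix_inversion`), so `q` is comparable with the squared Hilbert-Schmidt norm.

Data processing and the classical values alone make every quantum `f`-divergence comparable with
the same norm. From below, measuring in an eigenbasis of `ρ - π` reduces to the classical Pinsker
inequality (`exists_hsSq_le_div`). From above, `π = T Tᴴ` and `ρ = T diag(w) Tᴴ` for some `T`, and
both states are prepared from classical distributions with likelihood ratios `w`
(`div_le_classical`); as `f` vanishes to second order at `1`, the divergence is at most quadratic
as long as `w` stays in a compact subset of `(0, ∞)` (`exists_div_le_hsSq`). For the states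
`E^n(ρ)` this holds once `n` is large, since a primitive channel maps the compact set of states
into the positive definite matrices.

Hence `η_D(E^n, π) ≤ K η_{χ²}(E, π)^n` for large `n`, where `K` does not depend on `n`
(`sdpi_pow_le_mul_pow`), and the `n`-th root removes `K`. The limit exists by Fekete's lemma,
because `π` is a fixed point and `n ↦ η_D(E^n, π)` is therefore submultiplicative.

If the divergence is locally `χ²_g`, letting the states tend to `π` along segments gives
`q(E^n X) / q(X) ≤ η_D(E^n, π)` for `X = ρ - π` (`chiSq_pow_le_sdpi_mul`). Under detailed balance
`E` is self-adjoint for the inner product of `q`, so by Cauchy-Schwarz the sequence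
`n ↦ q(E^n X)` is log-convex and `q(E^n X) / q(X) ≥ (q(E X) / q(X))^n` (`pow_chiForm_le`). The two estimates give the
reverse inequality.
-/

noncomputable section

namespace QDiv

open Matrix Filter

variable {d : ℕ}

/-! ### Positive definite super-operators -/

lemma unitBasis_repr_apply (X : Mat d) (p : Fin d × Fin d) :
    (unitBasis d).repr X p = X p.1 p.2 := by
  have h : X = ∑ q : Fin d × Fin d, X q.1 q.2 • unitBasis d q := by
    conv_lhs => rw [matrix_eq_sum_single X]
    rw [Fintype.sum_prod_type]
    simp [Matrix.stdBasis_eq_single, Matrix.smul_single]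
  conv_lhs => rw [h]
  rw [Module.Basis.repr_sum_self]

/-- The Hilbert-Schmidt inner product in coordinates. -/
lemma trace_conjTranspose_mul_eq (X Y : Mat d) :
    (Xᴴ * Y).trace = star ⇑((unitBasis d).repr X) ⬝ᵥ ⇑((unitBasis d).repr Y) := by
  simp only [Matrix.trace, Matrix.diag, Matrix.mul_apply, dotProduct, conjTranspose_apply,
    Pi.star_apply, unitBasis_repr_apply, Fintype.sum_prod_type]
  exact Finset.sum_comm

lemma trace_conjTranspose_mul_apply_eq (T : SuperOp d) (X Y : Mat d) :
    (Xᴴ * T Y).trace = star ⇑((unitBasis d).repr X) ⬝ᵥ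
      (LinearMap.toMatrix (unitBasis d) (unitBasis d) T *ᵥ ⇑((unitBasis d).repr Y)) := by
  rw [LinearMap.toMatrix_mulVec_repr, trace_conjTranspose_mul_eq]

lemma trace_conjTranspose_mul_superAdjoint (T : SuperOp d) (X Y : Mat d) :
    (Xᴴ * superAdjoint T Y).trace = ((T X)ᴴ * Y).trace := by
  rw [trace_conjTranspose_mul_apply_eq, trace_conjTranspose_mul_eq, superAdjoint,
    LinearMap.toMatrix_toLin, dotProduct_mulVec, ← star_mulVec, LinearMap.toMatrix_mulVec_repr]

lemma trace_conjTranspose_mul_self_pos {X : Mat d} (hX : X ≠ 0) : 0 < (Xᴴ * X).trace :=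
  lt_of_le_of_ne (posSemidef_conjTranspose_mul_self X).trace_nonneg
    (fun h => hX (trace_conjTranspose_mul_self_eq_zero_iff.1 h.symm))

lemma exists_repr_eq (x : Fin d × Fin d → ℂ) : ∃ X : Mat d, ⇑((unitBasis d).repr X) = x :=
  ⟨Matrix.of fun i j => x (i, j), by ext p; rw [unitBasis_repr_apply]; rfl⟩

lemma posDef_toMatrix {T : SuperOp d} (h : ∀ X Y : Mat d, (Xᴴ * T Y).trace = ((T X)ᴴ * Y).trace)
    (hpos : ∀ X : Mat d, X ≠ 0 → 0 < (Xᴴ * T X).trace) :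
    (LinearMap.toMatrix (unitBasis d) (unitBasis d) T).PosDef := by
  refine PosDef.of_dotProduct_mulVec_pos ?_ fun x hx => ?_
  · have : superAdjoint T = T := by
      refine LinearMap.ext fun Y => ?_
      refine eq_of_sub_eq_zero (trace_conjTranspose_mul_self_eq_zero_iff.1 ?_)
      rw [mul_sub, trace_sub, trace_conjTranspose_mul_superAdjoint, h, sub_self]
    have h2 := congrArg (LinearMap.toMatrix (unitBasis d) (unitBasis d)) this
    rwa [superAdjoint, LinearMap.toMatrix_toLin] at h2
  · obtain ⟨X, rfl⟩ := exists_repr_eq x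
    rw [← trace_conjTranspose_mul_apply_eq]
    exact hpos X (by rintro rfl; exact hx (by ext; simp))

lemma exists_isUnit_conjTranspose_mul_self {n : Type*} [Fintype n] [DecidableEq n]
    {P : Matrix n n ℂ} (hP : P.PosDef) : ∃ B : Matrix n n ℂ, IsUnit B ∧ P = Bᴴ * B := by
  open scoped MatrixOrder in
  obtain ⟨B, hB⟩ := CStarAlgebra.nonneg_iff_eq_star_mul_self.mp hP.posSemidef.nonneg
  refine ⟨B, ?_, hB⟩
  have h := hP.isUnit
  rw [hB, star_eq_conjTranspose] at h
  rw [isUnit_iff_isUnit_det, det_mul] at h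
  exact (isUnit_iff_isUnit_det _).2 (isUnit_of_mul_isUnit_right h)

lemma posDef_toMatrix_mulLeft {P : Mat d} (hP : P.PosDef) :
    (LinearMap.toMatrix (unitBasis d) (unitBasis d) (LinearMap.mulLeft ℂ P)).PosDef := by
  refine posDef_toMatrix (fun X Y => ?_) fun X hX => ?_
  · simp [conjTranspose_mul, hP.isHermitian.eq, mul_assoc]
  · obtain ⟨B, hB, rfl⟩ := exists_isUnit_conjTranspose_mul_self hP
    have := trace_conjTranspose_mul_self_pos (X := B * X) (fun h => hX (hB.mul_right_eq_zero.1 h))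
    simpa [conjTranspose_mul, mul_assoc] using this

lemma posDef_toMatrix_mulRight {P : Mat d} (hP : P.PosDef) :
    (LinearMap.toMatrix (unitBasis d) (unitBasis d) (LinearMap.mulRight ℂ P)).PosDef := by
  refine posDef_toMatrix (fun X Y => ?_) fun X hX => ?_
  · rw [LinearMap.mulRight_apply, LinearMap.mulRight_apply, conjTranspose_mul, hP.isHermitian.eq,
      ← mul_assoc, trace_mul_comm, mul_assoc]
  · obtain ⟨B, hB, rfl⟩ := exists_isUnit_conjTranspose_mul_self hP
    have hB' : IsUnit Bᴴ := by simpa using hB.star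
    have := trace_conjTranspose_mul_self_pos (X := X * Bᴴ) (fun h => hX (hB'.mul_left_eq_zero.1 h))
    rw [conjTranspose_mul, conjTranspose_conjTranspose, trace_mul_comm, mul_assoc X,
      trace_mul_comm, mul_assoc] at this
    rw [LinearMap.mulRight_apply, ← mul_assoc, trace_mul_comm]
    convert this using 2
    simp only [mul_assoc]

lemma posDef_mul_of_commute {n : Type*} [Fintype n] [DecidableEq n] {A B : Matrix n n ℂ}
    (hA : A.PosDef) (hB : B.PosDef) (h : Commute A B) : (A * B).PosDef := by
  open scoped MatrixOrder in
  exact ((hA.isStrictlyPositive.commute_iff hB.isStrictlyPositive).1 h).posDef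

/-! ### Standard monotone functions and the inversion `Ω` -/

/-- Antitonicity gives positivity on `(0, 1]`, and the symmetry `g(x⁻¹) = x g(x)` transports it to
`[1, ∞)`. -/
lemma MemMst.pos {g : ℝ → ℝ} (hg : MemMst g) {x : ℝ} (hx : 0 < x) : 0 < g x := by
  have key : ∀ y : ℝ, 0 < y → y ≤ 1 → 0 < g y := by
    intro y hy hy1
    have h := hg.operatorAntitone 1 (algebraMap ℝ _ y) (algebraMap ℝ _ 1) ?_ ?_
    · rw [cfc_algebraMap, cfc_algebraMap, ← map_sub, algebraMap_eq_diagonal,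
        posSemidef_diagonal_iff] at h
      have h0 := h 0
      simp only [hg.map_one, Pi.algebraMap_apply, Complex.coe_algebraMap,
        Complex.zero_le_real] at h0
      linarith
    · rw [algebraMap_eq_diagonal, posDef_diagonal_iff]
      intro i; simpa using hy
    · rw [← map_sub, algebraMap_eq_diagonal, posSemidef_diagonal_iff]
      intro i
      simpa only [Pi.algebraMap_apply, Complex.coe_algebraMap, Pi.zero_apply,
        Complex.zero_le_real, sub_nonneg] using hy1
  rcases le_total x 1 with h | h
  · exact key x hx h
  · have := key x⁻¹ (inv_pos.2 hx) (inv_le_one_of_one_le₀ h)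
    rw [hg.symmetry x hx] at this
    exact (mul_pos_iff_of_pos_left hx).1 this

lemma posDef_cfc {n : Type*} [Fintype n] [DecidableEq n] {A : Matrix n n ℂ} (hA : A.PosDef)
    {g : ℝ → ℝ} (hg : ∀ x : ℝ, 0 < x → 0 < g x) : (cfc g A).PosDef := by
  rw [hA.isHermitian.cfc_eq, IsHermitian.cfc, Unitary.conjStarAlgAut_apply]
  have h : (diagonal (RCLike.ofReal ∘ g ∘ hA.isHermitian.eigenvalues) : Matrix n n ℂ).PosDef := by
    rw [posDef_diagonal_iff]
    intro i
    simpa using hg _ (hA.eigenvalues_pos i)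
  have hU : IsUnit (hA.isHermitian.eigenvectorUnitary : Matrix n n ℂ) :=
    Unitary.isUnit_coe
  exact (Matrix.IsUnit.posDef_star_right_conjugate_iff hU).2 h

lemma toMatrix_modularOp (P Q : Mat d) :
    LinearMap.toMatrix (unitBasis d) (unitBasis d) (modularOp P Q) =
      LinearMap.toMatrix (unitBasis d) (unitBasis d) (LinearMap.mulLeft ℂ P) *
      LinearMap.toMatrix (unitBasis d) (unitBasis d) (LinearMap.mulRight ℂ Q⁻¹) := by
  rw [modularOp, LinearMap.toMatrix_comp (unitBasis d) (unitBasis d)]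

lemma commute_toMatrix_mulLeft_mulRight (P Q : Mat d) :
    Commute (LinearMap.toMatrix (unitBasis d) (unitBasis d) (LinearMap.mulLeft ℂ P))
      (LinearMap.toMatrix (unitBasis d) (unitBasis d) (LinearMap.mulRight ℂ Q)) := by
  rw [commute_iff_eq, ← LinearMap.toMatrix_comp, ← LinearMap.toMatrix_comp]
  congr 1
  ext1 X
  simp [mul_assoc]

/-- `Ω_σ^g` is the product of the commuting positive definite operators `R_σ⁻¹` and `g(Δ_σ)`. -/
lemma posDef_toMatrix_inversion {g : ℝ → ℝ} (hg : MemMst g) {σ : Mat d} (hσ : σ.PosDef) :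
    (LinearMap.toMatrix (unitBasis d) (unitBasis d) (inversion g σ)).PosDef := by
  have hL := posDef_toMatrix_mulLeft hσ
  have hR := posDef_toMatrix_mulRight hσ.inv
  have hc := commute_toMatrix_mulLeft_mulRight σ σ⁻¹
  have hΔ := posDef_mul_of_commute hL hR hc
  have hg' := posDef_cfc hΔ (fun x hx => hg.pos hx)
  rw [inversion, LinearMap.toMatrix_comp (unitBasis d) (unitBasis d), superFun,
    LinearMap.toMatrix_toLin, toMatrix_modularOp]
  refine posDef_mul_of_commute hR hg' (Commute.symm ?_)
  exact Commute.cfc_real (hc.mul_left (Commute.refl _)) g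

/-- The quadratic form `X ↦ ⟨X, Ω_σ^g X⟩`, with real values, on all matrices. -/
def chiForm (g : ℝ → ℝ) (σ X : Mat d) : ℝ := ((Xᴴ * inversion g σ X).trace).re

lemma chiSq_eq (g : ℝ → ℝ) (ρ σ : Mat d) : chiSq g ρ σ = ENNReal.ofReal (chiForm g σ (ρ - σ)) :=
  rfl

lemma chiForm_pos {g : ℝ → ℝ} (hg : MemMst g) {σ : Mat d} (hσ : σ.PosDef) {X : Mat d}
    (hX : X ≠ 0) : 0 < chiForm g σ X := by
  rw [chiForm, trace_conjTranspose_mul_apply_eq]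
  refine (posDef_toMatrix_inversion hg hσ).re_dotProduct_pos ?_
  intro h
  exact hX ((unitBasis d).repr.map_eq_zero_iff.1 (DFunLike.coe_injective h))

lemma chiForm_smul (g : ℝ → ℝ) (σ X : Mat d) (t : ℝ) :
    chiForm g σ (t • X) = t ^ 2 * chiForm g σ X := by
  have : t • X = (t : ℂ) • X := by ext; simp
  rw [this, chiForm, chiForm, map_smul, conjTranspose_smul, smul_mul_smul_comm, trace_smul]
  simp [sq]

@[simp] lemma chiForm_zero (g : ℝ → ℝ) (σ : Mat d) : chiForm g σ 0 = 0 := by simp [chiForm]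

lemma chiForm_nonneg {g : ℝ → ℝ} (hg : MemMst g) {σ : Mat d} (hσ : σ.PosDef) (X : Mat d) :
    0 ≤ chiForm g σ X := by
  rcases eq_or_ne X 0 with rfl | h
  · simp
  · exact (chiForm_pos hg hσ h).le

lemma continuous_superOp (T : SuperOp d) : Continuous T :=
  LinearMap.continuous_of_finiteDimensional T

lemma continuous_chiForm (g : ℝ → ℝ) (σ : Mat d) : Continuous (chiForm g σ) := by
  unfold chiForm
  exact Complex.continuous_re.comp
    ((continuous_id.matrix_conjTranspose.matrix_mul (continuous_superOp _)).matrix_trace)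

/-! ### Detailed balance -/

lemma isUnit_inversion {g : ℝ → ℝ} (hg : MemMst g) {σ : Mat d} (hσ : σ.PosDef) :
    IsUnit (inversion g σ) := by
  rw [LinearMap.isUnit_iff_ker_eq_bot, LinearMap.ker_eq_bot']
  intro X hX
  by_contra h
  have := chiForm_pos hg hσ h
  simp [chiForm, hX] at this

/-- Under detailed balance `E` is self-adjoint for `⟨X, Ω_σ^g Y⟩`. -/
lemma DetailedBalance.trace_eq {g : ℝ → ℝ} (hg : MemMst g) {σ : Mat d} (hσ : σ.PosDef)
    {E : SuperOp d} (h : DetailedBalance g σ E) (X Y : Mat d) :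
    ((E X)ᴴ * inversion g σ Y).trace = (Xᴴ * inversion g σ (E Y)).trace := by
  have hu := isUnit_inversion hg hσ
  have h1 : superAdjoint E * inversion g σ = inversion g σ * E := by
    have h2 : Ring.inverse (inversion g σ) * superAdjoint E = E * Ring.inverse (inversion g σ) := by
      rw [Module.End.mul_eq_comp, Module.End.mul_eq_comp]
      exact h
    calc superAdjoint E * inversion g σ
        = inversion g σ * (Ring.inverse (inversion g σ) * superAdjoint E) * inversion g σ := by
          rw [← mul_assoc, Ring.mul_inverse_cancel _ hu, one_mul]
      _ = inversion g σ * E := by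
          rw [h2, mul_assoc, mul_assoc, Ring.inverse_mul_cancel _ hu, mul_one]
  rw [← trace_conjTranspose_mul_superAdjoint, ← Module.End.mul_apply, h1, Module.End.mul_apply]

lemma chiForm_sub_smul {g : ℝ → ℝ} {σ : Mat d} {E : SuperOp d}
    (h : ∀ X Y : Mat d, ((E X)ᴴ * inversion g σ Y).trace = (Xᴴ * inversion g σ (E Y)).trace)
    (X : Mat d) (t : ℝ) :
    chiForm g σ (X - t • E (E X)) =
      chiForm g σ X - 2 * t * chiForm g σ (E X) + t ^ 2 * chiForm g σ (E (E X)) := by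
  have ht : ∀ Z : Mat d, t • Z = (t : ℂ) • Z := fun Z => by ext; simp
  have e1 : (Xᴴ * inversion g σ (E (E X))).trace = ((E X)ᴴ * inversion g σ (E X)).trace :=
    (h X (E X)).symm
  have e2 : ((E (E X))ᴴ * inversion g σ X).trace = ((E X)ᴴ * inversion g σ (E X)).trace :=
    h (E X) X
  simp only [chiForm, ht, map_sub, map_smul, conjTranspose_sub, conjTranspose_smul, sub_mul,
    mul_sub, trace_sub, Matrix.smul_mul, Matrix.mul_smul, trace_smul, e1, e2]
  simp
  ring

/-- Log-convexity along the orbit of a self-adjoint operator: Cauchy-Schwarz in the form that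
`t ↦ q(X - t E²X) ≥ 0` has nonpositive discriminant. -/
lemma chiForm_sq_le {g : ℝ → ℝ} (hg : MemMst g) {σ : Mat d} (hσ : σ.PosDef) {E : SuperOp d}
    (h : DetailedBalance g σ E) (X : Mat d) :
    chiForm g σ (E X) ^ 2 ≤ chiForm g σ X * chiForm g σ (E (E X)) := by
  have key := discrim_le_zero (a := chiForm g σ (E (E X))) (b := -2 * chiForm g σ (E X))
    (c := chiForm g σ X) fun t => by
      have := chiForm_nonneg hg hσ (X - t • E (E X))
      rw [chiForm_sub_smul (h.trace_eq hg hσ)] at this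
      linarith
  rw [discrim] at key
  linarith

lemma pow_chiForm_le {g : ℝ → ℝ} (hg : MemMst g) {σ : Mat d} (hσ : σ.PosDef) {E : SuperOp d}
    (h : DetailedBalance g σ E) {X : Mat d} (hX : X ≠ 0) (n : ℕ) :
    (chiForm g σ (E X) / chiForm g σ X) ^ n ≤ chiForm g σ ((E ^ n) X) / chiForm g σ X := by
  set a : ℕ → ℝ := fun n => chiForm g σ ((E ^ n) X) with ha
  have hE : ∀ n, (E ^ (n + 1)) X = E ((E ^ n) X) := fun n => by rw [pow_succ']; rfl
  have a0 : 0 < a 0 := by simpa [ha] using chiForm_pos hg hσ hX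
  have an : ∀ n, 0 ≤ a n := fun n => chiForm_nonneg hg hσ _
  have hsq : ∀ n, a (n + 1) ^ 2 ≤ a n * a (n + 2) := fun n => by
    simp only [ha, hE]
    exact chiForm_sq_le hg hσ h _
  set r := a 1 / a 0 with hr
  have hr0 : 0 ≤ r := div_nonneg (an 1) a0.le
  have hr1 : r * a 0 = a 1 := div_mul_cancel₀ _ a0.ne'
  -- the ratios of consecutive terms increase
  have step : ∀ n, r * a n ≤ a (n + 1) := by
    intro n
    induction n with
    | zero => exact hr1.le
    | succ n ih =>
      rcases (an (n + 1)).eq_or_lt with h0 | h0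
      · rw [← h0, mul_zero]; exact an _
      · have hn : 0 < a n := by
          rcases (an n).eq_or_lt with h1 | h1
          · have := hsq n
            rw [← h1, zero_mul] at this
            nlinarith
          · exact h1
        have h2 : r * a n * a (n + 1) ≤ a n * a (n + 2) := by
          nlinarith [hsq n, mul_le_mul_of_nonneg_right ih h0.le]
        have h3 : a n * (r * a (n + 1)) ≤ a n * a (n + 2) := by linarith
        exact le_of_mul_le_mul_left h3 hn
  have hpow : ∀ n, r ^ n * a 0 ≤ a n := by
    intro n
    induction n with
    | zero => simp
    | succ n ih =>
      calc r ^ (n + 1) * a 0 = r * (r ^ n * a 0) := by ring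
        _ ≤ r * a n := mul_le_mul_of_nonneg_left ih hr0
        _ ≤ _ := step n
  have := (le_div_iff₀ a0).2 (hpow n)
  simpa [ha, hr] using this

/-! ### States and channels -/

lemma IsCompletelyPositive.posSemidef {E : SuperOp d} (hE : IsCompletelyPositive E) {X : Mat d}
    (hX : X.PosSemidef) : (E X).PosSemidef :=
  (hE 1 (Matrix.of fun _ _ => X) (hX.submatrix Prod.snd)).submatrix fun i => (0, i)

lemma IsChannel.isState {E : SuperOp d} (hE : IsChannel E) {ρ : Mat d} (hρ : IsState ρ) :
    IsState (E ρ) :=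
  ⟨hE.completelyPositive.posSemidef hρ.1, by rw [hE.tracePreserving, hρ.2]⟩

lemma IsChannel.isState_pow {E : SuperOp d} (hE : IsChannel E) {ρ : Mat d} (hρ : IsState ρ)
    (n : ℕ) : IsState ((E ^ n) ρ) := by
  induction n with
  | zero => exact hρ
  | succ n ih => rw [pow_succ', Module.End.mul_apply]; exact hE.isState ih

lemma pow_apply_fixed {E : SuperOp d} {π : Mat d} (h : E π = π) (n : ℕ) : (E ^ n) π = π := by
  induction n with
  | zero => rfl
  | succ n ih => rw [pow_succ', Module.End.mul_apply, ih, h]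

/-- Convex combinations, with the coefficients written as in `IsLocallyChiSq`. -/
lemma IsState.convexComb {ρ σ : Mat d} (hρ : IsState ρ) (hσ : IsState σ) {t : ℝ} (h0 : 0 ≤ t)
    (h1 : t ≤ 1) : IsState ((t : ℂ) • ρ + ((1 - t : ℝ) : ℂ) • σ) := by
  refine ⟨(hρ.1.smul (by exact_mod_cast h0)).add
    (hσ.1.smul (by exact_mod_cast sub_nonneg.2 h1)), ?_⟩
  rw [trace_add, trace_smul, trace_smul, hρ.2, hσ.2]
  simp

/-- The channel that measures in the orthonormal basis of the columns of `W` and prepares the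
state `τ j` on the outcome `j`. -/
def measurePrepare (W : Mat d) (τ : Fin d → Mat d) : SuperOp d where
  toFun X := ∑ j, (Wᴴ * X * W) j j • τ j
  map_add' X Y := by simp [mul_add, add_mul, add_smul, Finset.sum_add_distrib]
  map_smul' c X := by simp [Finset.smul_sum, smul_smul]

lemma measurePrepare_apply (W : Mat d) (τ : Fin d → Mat d) (X : Mat d) :
    measurePrepare W τ X = ∑ j, (Wᴴ * X * W) j j • τ j := rfl

lemma isChannel_measurePrepare {W : Mat d} (hW : W * Wᴴ = 1) {τ : Fin d → Mat d}
    (hτ : ∀ j, IsState (τ j)) : IsChannel (measurePrepare W τ) where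
  completelyPositive k X hX := by
    let A : Fin d → Matrix (Fin k) (Fin k) ℂ := fun j => Matrix.of fun a b => (Wᴴ * X a b * W) j j
    have hA : ∀ j, (A j).PosSemidef := fun j => by
      let B : Matrix (Fin k × Fin d) (Fin k) ℂ :=
        Matrix.of fun p l => if p.1 = l then W p.2 j else 0
      have hB : A j = Bᴴ * Matrix.comp (Fin k) (Fin k) (Fin d) (Fin d) ℂ X * B := by
        ext a b
        simp [A, B, Matrix.mul_apply, Fintype.sum_prod_type, Finset.sum_ite_irrel, apply_ite]
      rw [hB]
      exact hX.conjTranspose_mul_mul_same B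
    have h : Matrix.comp (Fin k) (Fin k) (Fin d) (Fin d) ℂ (X.map (measurePrepare W τ)) =
        ∑ j, kroneckerMap (· * ·) (A j) (τ j) := by
      ext p q
      simp [A, measurePrepare_apply, Matrix.sum_apply]
    rw [h]
    exact posSemidef_sum _ fun j _ => (hA j).kronecker (hτ j).1
  tracePreserving X := by
    rw [measurePrepare_apply, trace_sum]
    simp only [trace_smul, (hτ _).2, smul_eq_mul, mul_one]
    change (Wᴴ * X * W).trace = X.trace
    rw [trace_mul_comm, ← mul_assoc, hW, one_mul]

lemma trace_mul_diagonal_mul (T : Mat d) (w : Fin d → ℂ) :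
    (T * diagonal w * Tᴴ).trace = ∑ i, w i * (Tᴴ * T) i i := by
  rw [trace_mul_comm, ← mul_assoc]
  simp [Matrix.trace, mul_comm]

lemma sum_smul_mul_diagonal_mul (T : Mat d) (c : Fin d → ℂ) (t : Fin d → Fin d → ℂ) :
    ∑ j, c j • (T * diagonal (t j) * Tᴴ) = T * diagonal (fun i => ∑ j, c j * t j i) * Tᴴ := by
  have : diagonal (fun i => ∑ j, c j * t j i) = ∑ j, c j • diagonal (t j) := by
    ext a b
    by_cases h : a = b <;> simp [Matrix.sum_apply, h]
  rw [this, Matrix.mul_sum, Matrix.sum_mul]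
  simp

/-- The squared Hilbert-Schmidt norm. -/
def hsSq (X : Mat d) : ℝ := ((Xᴴ * X).trace).re

lemma hsSq_eq_sum (X : Mat d) : hsSq X = ∑ i, ∑ j, ‖X i j‖ ^ 2 := by
  simp only [hsSq, Matrix.trace, Matrix.diag, Matrix.mul_apply, conjTranspose_apply, Complex.re_sum]
  rw [Finset.sum_comm]
  refine Finset.sum_congr rfl fun i _ => Finset.sum_congr rfl fun j _ => ?_
  rw [Complex.star_def, ← Complex.normSq_eq_conj_mul_self, Complex.ofReal_re,
    Complex.normSq_eq_norm_sq]

lemma hsSq_pos {X : Mat d} (hX : X ≠ 0) : 0 < hsSq X :=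
  (Complex.pos_iff.1 (trace_conjTranspose_mul_self_pos hX)).1

lemma hsSq_smul (X : Mat d) (t : ℝ) : hsSq (t • X) = t ^ 2 * hsSq X := by
  simp only [hsSq_eq_sum, Finset.mul_sum, Matrix.smul_apply, norm_smul, mul_pow, Real.norm_eq_abs,
    sq_abs]

lemma continuous_hsSq : Continuous (hsSq : Mat d → ℝ) := by
  unfold hsSq
  exact Complex.continuous_re.comp
    ((continuous_id.matrix_conjTranspose.matrix_mul continuous_id).matrix_trace)

lemma hsSq_unitary_mul_diagonal {U : Mat d} (hU : Uᴴ * U = 1) (w : Fin d → ℝ) :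
    hsSq (U * diagonal (fun i => (w i : ℂ)) * Uᴴ) = ∑ i, w i ^ 2 := by
  have h : (U * diagonal (fun i => (w i : ℂ)) * Uᴴ)ᴴ * (U * diagonal (fun i => (w i : ℂ)) * Uᴴ) =
      U * diagonal (fun i => ((w i ^ 2 : ℝ) : ℂ)) * Uᴴ := by
    simp only [conjTranspose_mul, conjTranspose_conjTranspose, diagonal_conjTranspose, mul_assoc]
    rw [← mul_assoc Uᴴ U, hU, one_mul, ← mul_assoc (diagonal _) (diagonal _), diagonal_mul_diagonal]
    congr 3
    ext i
    simp [sq]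
  rw [hsSq, h, trace_mul_diagonal_mul, hU]
  simp only [one_apply_eq, mul_one, ← Complex.ofReal_sum, Complex.ofReal_re]

/-! ### Compactness -/

lemma isCompact_setOf_isState : IsCompact {ρ : Mat d | IsState ρ} := by
  have hc : IsCompact {B : Mat d | hsSq B = 1} := by
    have hsub : {B : Mat d | hsSq B = 1} ⊆
        Set.univ.pi fun _ => Set.univ.pi fun _ => Metric.closedBall (0 : ℂ) 1 := by
      intro B hB i _ j _
      rw [mem_closedBall_zero_iff, ← sq_le_one_iff₀ (norm_nonneg _), ← show hsSq B = 1 from hB,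
        hsSq_eq_sum]
      refine le_trans ?_ (Finset.single_le_sum (f := fun i => ∑ j, ‖B i j‖ ^ 2)
        (fun i _ => by positivity) (Finset.mem_univ i))
      exact Finset.single_le_sum (f := fun j => ‖B i j‖ ^ 2) (fun j _ => by positivity)
        (Finset.mem_univ j)
    refine IsCompact.of_isClosed_subset ?_ (isClosed_eq continuous_hsSq continuous_const) hsub
    exact isCompact_univ_pi fun _ => isCompact_univ_pi fun _ => isCompact_closedBall _ _
  convert hc.image (f := fun B : Mat d => Bᴴ * B)
    (continuous_id.matrix_conjTranspose.matrix_mul continuous_id)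
  ext ρ
  constructor
  · rintro ⟨h1, h2⟩
    open scoped MatrixOrder in
    obtain ⟨B, rfl⟩ := CStarAlgebra.nonneg_iff_eq_star_mul_self.mp h1.nonneg
    refine ⟨B, ?_, rfl⟩
    rw [star_eq_conjTranspose] at h2
    simp [hsSq, h2]
  · rintro ⟨B, hB, rfl⟩
    have h := posSemidef_conjTranspose_mul_self B
    exact ⟨h, Complex.ext hB (Complex.nonneg_iff.1 h.trace_nonneg).2.symm⟩

/-- Comparison of families of quadratic forms, by compactness of the unit sphere. -/
lemma exists_forall_le_mul_of_isCompact {P V : Type*} [TopologicalSpace P] [NormedAddCommGroup V]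
    [NormedSpace ℝ V] [FiniteDimensional ℝ V] {s : Set P} (hs : IsCompact s)
    {Q₁ Q₂ : P → V → ℝ} (h₁ : Continuous fun x : P × V => Q₁ x.1 x.2)
    (h₂ : Continuous fun x : P × V => Q₂ x.1 x.2)
    (hom₁ : ∀ p v (t : ℝ), Q₁ p (t • v) = t ^ 2 * Q₁ p v)
    (hom₂ : ∀ p v (t : ℝ), Q₂ p (t • v) = t ^ 2 * Q₂ p v)
    (hpos : ∀ p ∈ s, ∀ v ≠ 0, 0 < Q₂ p v) :
    ∃ K : ℝ, 0 < K ∧ ∀ p ∈ s, ∀ v, Q₁ p v ≤ K * Q₂ p v := by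
  have hne : ∀ x ∈ s ×ˢ Metric.sphere (0 : V) 1, 0 < Q₂ x.1 x.2 := fun x hx =>
    hpos _ hx.1 _ (Metric.ne_of_mem_sphere hx.2 one_ne_zero)
  obtain ⟨M, hM⟩ := ((hs.prod (isCompact_sphere (0 : V) 1)).image_of_continuousOn
    (h₁.continuousOn.div h₂.continuousOn fun x hx => (hne x hx).ne')).bddAbove
  refine ⟨max M 1, by positivity, fun p hp v => ?_⟩
  rcases eq_or_ne v 0 with rfl | hv
  · have e₁ := hom₁ p 0 0
    have e₂ := hom₂ p 0 0
    simp only [smul_zero, ne_eq, OfNat.ofNat_ne_zero, not_false_eq_true, zero_pow,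
      zero_mul] at e₁ e₂
    rw [e₁, e₂, mul_zero]
  · have hn : ‖v‖ ≠ 0 := norm_ne_zero_iff.2 hv
    have hu : ‖v‖⁻¹ • v ∈ Metric.sphere (0 : V) 1 := by
      rw [mem_sphere_zero_iff_norm, norm_smul, norm_inv, norm_norm, inv_mul_cancel₀ hn]
    have hx : (p, ‖v‖⁻¹ • v) ∈ s ×ˢ Metric.sphere (0 : V) 1 := ⟨hp, hu⟩
    have hle := hM (Set.mem_image_of_mem _ hx)
    rw [Pi.div_apply, div_le_iff₀ (hne _ hx)] at hle
    have hv' : v = ‖v‖ • ‖v‖⁻¹ • v := by rw [smul_smul, mul_inv_cancel₀ hn, one_smul]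
    rw [hv', hom₁, hom₂]
    calc ‖v‖ ^ 2 * Q₁ p (‖v‖⁻¹ • v) ≤ ‖v‖ ^ 2 * (max M 1 * Q₂ p (‖v‖⁻¹ • v)) := by
          refine mul_le_mul_of_nonneg_left (hle.trans ?_) (by positivity)
          exact mul_le_mul_of_nonneg_right (le_max_left _ _) (hne _ hx).le
      _ = _ := by ring

attribute [local instance] Matrix.normedAddCommGroup Matrix.normedSpace in
lemma exists_forall_le_mul {Q₁ Q₂ : Mat d → ℝ} (h₁ : Continuous Q₁) (h₂ : Continuous Q₂)
    (hom₁ : ∀ v (t : ℝ), Q₁ (t • v) = t ^ 2 * Q₁ v)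
    (hom₂ : ∀ v (t : ℝ), Q₂ (t • v) = t ^ 2 * Q₂ v)
    (hpos : ∀ v ≠ 0, 0 < Q₂ v) : ∃ K : ℝ, 0 < K ∧ ∀ v, Q₁ v ≤ K * Q₂ v := by
  obtain ⟨K, hK, h⟩ := exists_forall_le_mul_of_isCompact (P := Unit) (V := Mat d)
    (s := Set.univ) isCompact_univ (Q₁ := fun _ => Q₁) (Q₂ := fun _ => Q₂)
    (h₁.comp continuous_snd) (h₂.comp continuous_snd) (fun _ => hom₁) (fun _ => hom₂)
    (fun _ _ => hpos)
  exact ⟨K, hK, h () trivial⟩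

/-- Uniform comparison in the Loewner order over all states. -/
lemma exists_forall_posSemidef_sub {F G : Mat d → Mat d} (hF : Continuous F) (hG : Continuous G)
    (hFpos : ∀ ρ, IsState ρ → (F ρ).PosDef) (hGh : ∀ ρ, IsState ρ → (G ρ).IsHermitian) :
    ∃ K : ℝ, 0 < K ∧ ∀ ρ, IsState ρ → (K • F ρ - G ρ).PosSemidef := by
  let Q : (Mat d → Mat d) → Mat d → (Fin d → ℂ) → ℝ := fun F ρ x => (star x ⬝ᵥ (F ρ *ᵥ x)).re
  have hc : ∀ F, Continuous F → Continuous fun x : Mat d × (Fin d → ℂ) => Q F x.1 x.2 := by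
    intro F hF
    exact Complex.continuous_re.comp (continuous_snd.star.dotProduct
      ((hF.comp continuous_fst).matrix_mulVec continuous_snd))
  have hom : ∀ F p v (t : ℝ), Q F p (t • v) = t ^ 2 * Q F p v := by
    intro F p v t
    have : t • v = (t : ℂ) • v := by ext; simp
    simp only [Q, this, star_smul, mulVec_smul, dotProduct_smul, smul_dotProduct]
    simp [sq, mul_assoc]
  obtain ⟨K, hK, h⟩ := exists_forall_le_mul_of_isCompact isCompact_setOf_isState (hc G hG)
    (hc F hF) (hom G) (hom F) fun ρ hρ v hv => (hFpos ρ hρ).re_dotProduct_pos hv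
  refine ⟨K, hK, fun ρ hρ => ?_⟩
  have hH : (K • F ρ - G ρ).IsHermitian := by
    refine IsHermitian.sub ?_ (hGh ρ hρ)
    rw [IsHermitian, conjTranspose_smul, (hFpos ρ hρ).isHermitian.eq, star_trivial]
  refine .of_dotProduct_mulVec_nonneg hH fun x => ?_
  rw [Complex.nonneg_iff]
  refine ⟨?_, (hH.im_star_dotProduct_mulVec_self x).symm⟩
  have := h ρ hρ x
  simp only [Q] at this
  rw [sub_mulVec, dotProduct_sub, smul_mulVec, dotProduct_smul, Complex.sub_re, Complex.smul_re]
  simpa using this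

/-! ### Quantum `f`-divergences are comparable with the squared Hilbert-Schmidt distance -/

/-- Spectral decomposition of a Hermitian matrix. -/
lemma exists_eq_unitary_mul_diagonal {H : Mat d} (hH : H.IsHermitian) :
    ∃ (U : Mat d) (w : Fin d → ℝ), Uᴴ * U = 1 ∧ U * Uᴴ = 1 ∧
      H = U * diagonal (fun i => (w i : ℂ)) * Uᴴ := by
  refine ⟨hH.eigenvectorUnitary, hH.eigenvalues, ?_, ?_, ?_⟩
  · exact Unitary.coe_star_mul_self hH.eigenvectorUnitary
  · exact Unitary.coe_mul_star_self hH.eigenvectorUnitary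
  · have := hH.spectral_theorem
    rwa [Unitary.conjStarAlgAut_apply] at this

lemma isState_mul_diagonal_mul {T : Mat d} {w : Fin d → ℝ} (hw : ∀ i, 0 ≤ w i)
    (h1 : ∑ i, (w i : ℂ) * (Tᴴ * T) i i = 1) :
    IsState (T * diagonal (fun i => (w i : ℂ)) * Tᴴ) := by
  refine ⟨PosSemidef.mul_mul_conjTranspose_same ?_ T, by rw [trace_mul_diagonal_mul, h1]⟩
  rw [posSemidef_diagonal_iff]
  exact fun i => by exact_mod_cast hw i

lemma coe_re_diag {A : Mat d} (hA : A.PosSemidef) (i : Fin d) :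
    (((A i i).re : ℝ) : ℂ) = A i i :=
  Complex.ext rfl (Complex.nonneg_iff.1 (hA.diag_nonneg (i := i))).2

/-- The Pinsker inequality passes to quantum divergences: measuring in an eigenbasis of `ρ - π`
loses none of the distance. Mixing the outcome with the uniform distribution makes both
probability vectors strictly positive and costs a factor `4`. -/
lemma exists_hsSq_le_div {f : ℝ → ℝ} (hf : MemFPin f) {D : Mat d → Mat d → ℝ≥0∞}
    (hD : IsQuantumFDivergence f D) {π : Mat d} (hπ : IsState π) :
    ∃ c : ℝ, 0 < c ∧ ∀ ρ, IsState ρ → ENNReal.ofReal (c * hsSq (ρ - π)) ≤ D ρ π := by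
  obtain ⟨C, hC, hpin⟩ := hf.pinsker d
  refine ⟨C / 4, by positivity, fun ρ hρ => ?_⟩
  have hd : (0 : ℝ) < d := by
    rcases Nat.eq_zero_or_pos d with rfl | h
    · have := hπ.2
      simp [Matrix.trace] at this
    · exact_mod_cast h
  obtain ⟨U, w, hU, hU', hH⟩ := exists_eq_unitary_mul_diagonal
    (hρ.1.isHermitian.sub hπ.1.isHermitian)
  have hconj : ∀ X : Mat d, (Uᴴ * X * U).trace = X.trace := fun X => by
    rw [trace_mul_comm, ← mul_assoc, hU', one_mul]
  let t : Fin d → Fin d → ℝ := fun j i => (if i = j then 1 / 2 else 0) + 1 / (2 * d)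
  have ht : ∀ j, ∑ i, t j i = 1 := fun j => by
    simp only [t, Finset.sum_add_distrib, Finset.sum_ite_eq', Finset.mem_univ, if_true,
      Finset.sum_const, Finset.card_univ, Fintype.card_fin, nsmul_eq_mul]
    field_simp
    norm_num
  let τ : Fin d → Mat d := fun j => U * diagonal (fun i => (t j i : ℂ)) * Uᴴ
  have hτ : ∀ j, IsState (τ j) := fun j => by
    refine isState_mul_diagonal_mul (fun i => ?_) ?_
    · simp only [t]; split_ifs <;> positivity
    · rw [hU]
      simp only [one_apply_eq, mul_one]
      exact_mod_cast ht j
  have hΦ := isChannel_measurePrepare hU' hτ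
  let a : Mat d → Fin d → ℝ := fun X i => ((Uᴴ * X * U) i i).re
  let p : Mat d → Fin d → ℝ := fun X i => a X i / 2 + 1 / (2 * d)
  have ha : ∀ X : Mat d, IsState X → ∑ i, a X i = 1 := fun X hX => by
    have := congrArg Complex.re (hconj X)
    rw [hX.2] at this
    simpa [Matrix.trace, a] using this
  have ha0 : ∀ X : Mat d, IsState X → ∀ i, 0 ≤ a X i := fun X hX i =>
    (Complex.nonneg_iff.1 (hX.1.conjTranspose_mul_mul_same U).diag_nonneg).1
  have hp : ∀ X : Mat d, IsState X → IsPosProb (p X) := fun X hX => by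
    refine ⟨fun i => ?_, ?_⟩
    · have := ha0 X hX i
      simp only [p]; positivity
    · simp only [p, Finset.sum_add_distrib, ← Finset.sum_div, ha X hX, Finset.sum_const,
        Finset.card_univ, Fintype.card_fin, nsmul_eq_mul]
      field_simp
      norm_num
  have hΦp : ∀ X : Mat d, IsState X →
      measurePrepare U τ X = U * diagonal (fun i => (p X i : ℂ)) * star U := fun X hX => by
    rw [measurePrepare_apply, sum_smul_mul_diagonal_mul, star_eq_conjTranspose]
    congr 3
    ext i
    have hX' := hX.1.conjTranspose_mul_mul_same U
    have h1 : ∀ j, (Uᴴ * X * U) j j = (a X j : ℂ) := fun j => (coe_re_diag hX' j).symm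
    simp only [h1]
    rw [← Complex.ofReal_inj.2 (show ∑ j, a X j * t j i = p X i from ?_)]
    · push_cast; rfl
    · simp only [t, mul_add, Finset.sum_add_distrib, mul_ite, mul_zero, Finset.sum_ite_eq,
        Finset.mem_univ, if_true, ← Finset.sum_mul, ha X hX, p]
      ring
  have hdiff : ∀ i, p ρ i - p π i = w i / 2 := fun i => by
    have h1 : (Uᴴ * (ρ - π) * U) i i = w i := by
      rw [hH, ← mul_assoc, ← mul_assoc, hU, one_mul, mul_assoc, hU, mul_one, diagonal_apply_eq]
    have h2 : a ρ i - a π i = w i := by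
      rw [mul_sub, sub_mul, Matrix.sub_apply] at h1
      have := congrArg Complex.re h1
      simpa using this
    simp only [p]
    linarith
  refine le_trans ?_ (hD.dataProcessing _ hΦ ρ π hρ hπ)
  rw [hΦp ρ hρ, hΦp π hπ, hD.classicalConsistency U
    (mem_unitaryGroup_iff.2 hU') _ _ (hp ρ hρ) (hp π hπ)]
  refine ENNReal.ofReal_le_ofReal (le_trans ?_ (hpin _ _ (hp ρ hρ) (hp π hπ)))
  rw [hH, hsSq_unitary_mul_diagonal hU]
  have hsq : ∑ i, |w i / 2| ^ 2 ≤ (∑ i, |w i / 2|) ^ 2 :=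
    Finset.sum_sq_le_sq_sum_of_nonneg fun i _ => abs_nonneg _
  simp only [hdiff]
  refine le_trans (le_of_eq ?_) (mul_le_mul_of_nonneg_left hsq hC.le)
  simp only [sq_abs, div_pow, ← Finset.sum_div]
  ring

/-- A function in the class `𝓕` vanishes to second order at `1`. -/
lemma MemF.exists_le_mul_sq {f : ℝ → ℝ} (hf : MemF f) {a b : ℝ} (ha : 0 < a) :
    ∃ K : ℝ, 0 < K ∧ ∀ x ∈ Set.Icc a b, f x ≤ K * (x - 1) ^ 2 := by
  have hsub : Set.Icc (min a 1) (max b 1) ⊆ Set.Ioi 0 := fun x hx =>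
    lt_of_lt_of_le (lt_min ha one_pos) hx.1
  have hf1 : ContDiffOn ℝ 1 (deriv f) (Set.Ioi 0) :=
    hf.contDiffOn.deriv_of_isOpen isOpen_Ioi (by norm_num)
  have hf2 : ContinuousOn (deriv (deriv f)) (Set.Ioi 0) :=
    hf1.continuousOn_deriv_of_isOpen isOpen_Ioi le_rfl
  obtain ⟨M, hM⟩ := isCompact_Icc.exists_bound_of_continuousOn (hf2.mono hsub)
  have h1 : (1 : ℝ) ∈ Set.Icc (min a 1) (max b 1) := ⟨min_le_right _ _, le_max_right _ _⟩
  have hd : ∀ x ∈ Set.Ioi (0 : ℝ), DifferentiableAt ℝ f x := fun x hx =>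
    (hf.contDiffOn.differentiableOn (by norm_num)).differentiableAt (isOpen_Ioi.mem_nhds hx)
  have hd' : ∀ x ∈ Set.Ioi (0 : ℝ), DifferentiableAt ℝ (deriv f) x := fun x hx =>
    (hf1.differentiableOn one_ne_zero).differentiableAt (isOpen_Ioi.mem_nhds hx)
  have hderiv : ∀ x ∈ Set.Icc (min a 1) (max b 1), ‖deriv f x‖ ≤ M * ‖x - 1‖ := fun x hx => by
    have := (convex_Icc (min a 1) (max b 1)).norm_image_sub_le_of_norm_deriv_le
      (fun y hy => hd' y (hsub hy)) hM h1 hx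
    rwa [hf.deriv_one, sub_zero] at this
  have hM0 : 0 ≤ M := (norm_nonneg _).trans (hM 1 h1)
  refine ⟨M + 1, by positivity, fun x hx => ?_⟩
  have hx' : x ∈ Set.Icc (min a 1) (max b 1) :=
    ⟨(min_le_left _ _).trans hx.1, hx.2.trans (le_max_left _ _)⟩
  have hseg : Set.uIcc 1 x ⊆ Set.Icc (min a 1) (max b 1) := Set.uIcc_subset_Icc h1 hx'
  have := (convex_uIcc 1 x).norm_image_sub_le_of_norm_deriv_le (f := f) (C := M * ‖x - 1‖)
    (fun y hy => hd y (hsub (hseg hy)))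
    (fun y hy => (hderiv y (hseg hy)).trans (mul_le_mul_of_nonneg_left ?_ hM0))
    Set.left_mem_uIcc Set.right_mem_uIcc
  · rw [hf.map_one, sub_zero] at this
    calc f x ≤ ‖f x‖ := Real.le_norm_self _
      _ ≤ M * ‖x - 1‖ * ‖x - 1‖ := this
      _ = M * (x - 1) ^ 2 := by rw [mul_assoc, Real.norm_eq_abs, abs_mul_abs_self, sq]
      _ ≤ _ := by gcongr; linarith
  · rw [Real.norm_eq_abs, Real.norm_eq_abs]
    exact Set.abs_sub_left_of_mem_uIcc hy

/-- The divergence is at most the classical one of any pair of probability vectors from which the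
two states can be prepared. For `ρ = T diag(w) Tᴴ` and `π = T Tᴴ`, preparing the normalized columns
of `T` does this. -/
lemma div_le_classical {f : ℝ → ℝ} {D : Mat d → Mat d → ℝ≥0∞}
    (hD : IsQuantumFDivergence f D) {T : Mat d} {w : Fin d → ℝ} (hw : ∀ i, 0 < w i)
    (hq : ∀ i, 0 < ((Tᴴ * T) i i).re) (hπ : IsState (T * Tᴴ))
    (hρ : IsState (T * diagonal (fun i => (w i : ℂ)) * Tᴴ)) :
    D (T * diagonal (fun i => (w i : ℂ)) * Tᴴ) (T * Tᴴ) ≤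
      ENNReal.ofReal (∑ i, ((Tᴴ * T) i i).re * f (w i)) := by
  let q : Fin d → ℝ := fun i => ((Tᴴ * T) i i).re
  have hqc : ∀ i, (Tᴴ * T) i i = (q i : ℂ) := fun i =>
    (coe_re_diag (posSemidef_conjTranspose_mul_self T) i).symm
  have hq0 : ∀ i, q i ≠ 0 := fun i => (hq i).ne'
  have sum_eq : ∀ v : Fin d → ℝ, (T * diagonal (fun i => (v i : ℂ)) * Tᴴ).trace =
      ((∑ i, v i * q i : ℝ) : ℂ) := fun v => by
    rw [trace_mul_diagonal_mul]
    simp only [hqc]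
    push_cast; rfl
  have hone : T * Tᴴ = T * diagonal (fun i => (((fun _ => 1 : Fin d → ℝ) i : ℝ) : ℂ)) * Tᴴ := by
    simp
  have hqprob : IsPosProb q := by
    refine ⟨hq, ?_⟩
    have := hπ.2
    rw [hone, sum_eq] at this
    simpa using Complex.ofReal_inj.1 (this.trans Complex.ofReal_one.symm)
  have hpprob : IsPosProb fun i => w i * q i := by
    refine ⟨fun i => mul_pos (hw i) (hq i), ?_⟩
    have := hρ.2
    rw [sum_eq] at this
    exact Complex.ofReal_inj.1 (this.trans Complex.ofReal_one.symm)
  let t : Fin d → Fin d → ℝ := fun j i => if i = j then (q i)⁻¹ else 0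
  let τ : Fin d → Mat d := fun j => T * diagonal (fun i => (t j i : ℂ)) * Tᴴ
  have hτ : ∀ j, IsState (τ j) := fun j => by
    refine isState_mul_diagonal_mul (fun i => ?_) ?_
    · simp only [t]; split_ifs
      · exact inv_nonneg.2 (hq i).le
      · exact le_rfl
    · rw [← trace_mul_diagonal_mul, sum_eq]
      simp [t, hq0]
  have hΦ := isChannel_measurePrepare (W := 1) (by simp) hτ
  have hΦp : ∀ v : Fin d → ℝ, measurePrepare 1 τ (diagonal fun i => ((v i * q i : ℝ) : ℂ)) =
      T * diagonal (fun i => (v i : ℂ)) * Tᴴ := fun v => by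
    rw [measurePrepare_apply, sum_smul_mul_diagonal_mul]
    congr 3
    ext i
    have : (q i : ℂ) ≠ 0 := by exact_mod_cast hq0 i
    simp [t, this, apply_ite]
  have hst : ∀ v : Fin d → ℝ, IsPosProb v → IsState (diagonal fun i => ((v i : ℝ) : ℂ)) :=
    fun v hv => by
      refine ⟨posSemidef_diagonal_iff.2 fun i => by exact_mod_cast (hv.1 i).le, ?_⟩
      rw [trace_diagonal]
      exact_mod_cast hv.2
  have h := hD.dataProcessing _ hΦ _ _ (hst _ hpprob) (hst _ hqprob)
  have hc := hD.classicalConsistency 1 (one_mem _) _ _ hpprob hqprob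
  rw [star_one, one_mul, mul_one, one_mul, mul_one] at hc
  have hΦq := hΦp fun _ => 1
  simp only [one_mul, ← hone] at hΦq
  rw [hΦp w, hΦq, hc] at h
  refine h.trans (le_of_eq ?_)
  congr 1
  refine Finset.sum_congr rfl fun i _ => ?_
  change q i * f (w i * q i / q i) = q i * f (w i)
  rw [mul_div_cancel_right₀ _ (hq0 i)]

/-- On the states above a positive multiple of `π`, the divergence is at most quadratic: for
`π = S Sᴴ`, diagonalizing `S⁻¹ ρ S⁻ᴴ` exhibits `ρ` and `π` as prepared from two classical
distributions whose likelihood ratios stay in a compact part of `(0, ∞)`. -/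
lemma exists_div_le_hsSq {f : ℝ → ℝ} (hf : MemF f) {D : Mat d → Mat d → ℝ≥0∞}
    (hD : IsQuantumFDivergence f D) {π : Mat d} (hπ : IsState π) (hπpos : π.PosDef) {a : ℝ}
    (ha : 0 < a) :
    ∃ K : ℝ, 0 < K ∧ ∀ ρ, IsState ρ → (ρ - a • π).PosSemidef →
      D ρ π ≤ ENNReal.ofReal (K * hsSq (ρ - π)) := by
  obtain ⟨b, -, hb⟩ := exists_forall_posSemidef_sub (F := fun _ => π) (G := id)
    continuous_const continuous_id (fun _ _ => hπpos) (fun ρ hρ => hρ.1.isHermitian)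
  obtain ⟨B, hB, hπB⟩ := exists_isUnit_conjTranspose_mul_self hπpos
  obtain ⟨K₁, hK₁, hfK⟩ := hf.exists_le_mul_sq (b := b) ha
  have hdet : IsUnit B.det := (isUnit_iff_isUnit_det _).1 hB
  have hBinv : B * B⁻¹ = 1 := mul_nonsing_inv _ hdet
  have hinv_adj : (B⁻¹)ᴴ * Bᴴ = 1 := by rw [← conjTranspose_mul, hBinv, conjTranspose_one]
  have hinv : B⁻¹ * B = 1 := nonsing_inv_mul _ hdet
  have hadj_inv : Bᴴ * (B⁻¹)ᴴ = 1 := by rw [← conjTranspose_mul, hinv, conjTranspose_one]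
  have hcont : Continuous fun X : Mat d => (B⁻¹)ᴴ * X * B⁻¹ :=
    (continuous_const.matrix_mul continuous_id).matrix_mul continuous_const
  obtain ⟨K₂, hK₂, hhs⟩ := exists_forall_le_mul
    (Q₁ := fun X : Mat d => hsSq ((B⁻¹)ᴴ * X * B⁻¹)) (Q₂ := hsSq)
    (continuous_hsSq.comp hcont) continuous_hsSq
    (fun X t => by rw [Matrix.mul_smul, Matrix.smul_mul, hsSq_smul]) (fun X t => hsSq_smul X t)
    (fun X hX => hsSq_pos hX)
  refine ⟨K₁ * K₂, by positivity, fun ρ hρ hρa => ?_⟩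
  obtain ⟨U, w, hU, hU', hH⟩ := exists_eq_unitary_mul_diagonal (H := (B⁻¹)ᴴ * ρ * B⁻¹)
    (by
      have := hρ.1.conjTranspose_mul_mul_same (B⁻¹)
      exact this.isHermitian)
  set T : Mat d := Bᴴ * U with hT
  have hTT : T * Tᴴ = π := by
    rw [hT, conjTranspose_mul, conjTranspose_conjTranspose, mul_assoc, ← mul_assoc U, hU', one_mul,
      hπB]
  have hTρ : T * diagonal (fun i => (w i : ℂ)) * Tᴴ = ρ := by
    calc T * diagonal (fun i => (w i : ℂ)) * Tᴴ
        = Bᴴ * (U * diagonal (fun i => (w i : ℂ)) * Uᴴ) * B := by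
          rw [hT, conjTranspose_mul, conjTranspose_conjTranspose]; simp only [mul_assoc]
      _ = (Bᴴ * (B⁻¹)ᴴ) * ρ * (B⁻¹ * B) := by rw [← hH]; simp only [mul_assoc]
      _ = ρ := by rw [hadj_inv, hinv, one_mul, mul_one]
  -- `R` inverts `T`, so the order relations between `ρ` and `π` can be read off from `w`
  set R : Mat d := B⁻¹ * U with hR
  have hRT : Rᴴ * T = 1 := by
    rw [hR, hT, conjTranspose_mul, mul_assoc, ← mul_assoc _ Bᴴ, hinv_adj, one_mul, hU]
  have hTR : Tᴴ * R = 1 := by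
    rw [← conjTranspose_conjTranspose (Tᴴ * R), conjTranspose_mul, conjTranspose_conjTranspose,
      hRT, conjTranspose_one]
  clear_value R T
  have hRρ : Rᴴ * ρ * R = diagonal fun i => (w i : ℂ) := by
    rw [← hTρ, ← mul_assoc, ← mul_assoc, hRT, one_mul, mul_assoc, hTR, mul_one]
  have hRπ : Rᴴ * π * R = 1 := by
    rw [← hTT, ← mul_assoc, hRT, one_mul, hTR]
  have hwa : ∀ i, a ≤ w i := fun i => by
    have := (hρa.conjTranspose_mul_mul_same R).diag_nonneg (i := i)
    rw [mul_sub, sub_mul, hRρ, Matrix.mul_smul, Matrix.smul_mul, hRπ] at this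
    simpa using (Complex.nonneg_iff.1 this).1
  have hwb : ∀ i, w i ≤ b := fun i => by
    have := ((hb ρ hρ).conjTranspose_mul_mul_same R).diag_nonneg (i := i)
    rw [mul_sub, sub_mul, id, hRρ, Matrix.mul_smul, Matrix.smul_mul, hRπ] at this
    simpa using (Complex.nonneg_iff.1 this).1
  have hTpos : (Tᴴ * T).PosDef := by
    refine PosDef.conjTranspose_mul_self T (mulVec_injective_iff_isUnit.2 ?_)
    exact (isUnit_iff_isUnit_det _).2 (isUnit_det_of_left_inverse hRT)
  have hq : ∀ i, 0 < ((Tᴴ * T) i i).re := fun i => (Complex.pos_iff.1 (hTpos.diag_pos (i := i))).1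
  have hq1 : ∀ i, ((Tᴴ * T) i i).re ≤ 1 := fun i => by
    have h1 : ∑ i, ((Tᴴ * T) i i).re = 1 := by
      have := congrArg Complex.re hπ.2
      rw [← hTT, trace_mul_comm] at this
      simpa [Matrix.trace] using this
    rw [← h1]
    exact Finset.single_le_sum (f := fun i => ((Tᴴ * T) i i).re) (fun i _ => (hq i).le)
      (Finset.mem_univ i)
  have hmain := div_le_classical hD (fun i => ha.trans_le (hwa i)) hq (hTT.symm ▸ hπ)
    (hTρ.symm ▸ hρ)
  rw [hTρ, hTT] at hmain
  refine hmain.trans (ENNReal.ofReal_le_ofReal ?_)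
  have hsum : hsSq ((B⁻¹)ᴴ * (ρ - π) * B⁻¹) = ∑ i, (w i - 1) ^ 2 := by
    rw [← hsSq_unitary_mul_diagonal hU]
    congr 1
    have hpi : (B⁻¹)ᴴ * π * B⁻¹ = 1 := by
      rw [hπB, ← mul_assoc, hinv_adj, one_mul, hBinv]
    have hdiag : diagonal (fun i => ((w i - 1 : ℝ) : ℂ)) =
        diagonal (fun i => (w i : ℂ)) - (1 : Mat d) := by
      rw [← diagonal_one, diagonal_sub]
      simp
    rw [mul_sub, sub_mul, hH, hpi, hdiag, mul_sub, sub_mul, mul_one, hU']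
  calc ∑ i, ((Tᴴ * T) i i).re * f (w i) ≤ ∑ i, K₁ * (w i - 1) ^ 2 := by
        refine Finset.sum_le_sum fun i _ => ?_
        have h0 := hf.nonneg (w i) (ha.trans_le (hwa i))
        have h1 := hfK (w i) ⟨hwa i, hwb i⟩
        nlinarith [hq1 i, hq i]
    _ = K₁ * hsSq ((B⁻¹)ᴴ * (ρ - π) * B⁻¹) := by rw [hsum, Finset.mul_sum]
    _ ≤ K₁ * (K₂ * hsSq (ρ - π)) := mul_le_mul_of_nonneg_left (hhs _) hK₁.le
    _ = _ := by ring

/-! ### Submultiplicative sequences -/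

/-- Fekete's lemma for submultiplicative sequences in `[0, 1]`. The limit may be `0`, so that
`log ∘ u` need not be bounded below by a linear function, or even be finite. -/
lemma exists_tendsto_rpow_of_submultiplicative {u : ℕ → ℝ≥0∞} (h1 : ∀ n, u n ≤ 1)
    (hmul : ∀ m n, u (m + n) ≤ u m * u n) :
    ∃ L : ℝ≥0∞, Tendsto (fun n : ℕ => u n ^ (1 / (n : ℝ))) atTop (𝓝 L) := by
  by_cases hz : ∃ m, u m = 0
  · obtain ⟨m, hm⟩ := hz
    refine ⟨0, tendsto_const_nhds.congr' ?_⟩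
    filter_upwards [eventually_ge_atTop m, eventually_gt_atTop 0] with n hn hn0
    have : u n = 0 := by
      obtain ⟨k, rfl⟩ := Nat.exists_eq_add_of_le hn
      simpa [hm] using hmul m k
    rw [this, ENNReal.zero_rpow_of_pos (by positivity)]
  push Not at hz
  have hfin : ∀ n, u n ≠ ⊤ := fun n => ((h1 n).trans_lt ENNReal.one_lt_top).ne
  have hpos : ∀ n, 0 < (u n).toReal := fun n => ENNReal.toReal_pos (hz n) (hfin n)
  let s : ℕ → ℝ := fun n => Real.log (u n).toReal
  have hs : Subadditive s := fun m n => by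
    simp only [s]
    rw [← Real.log_mul (hpos m).ne' (hpos n).ne', ← ENNReal.toReal_mul]
    exact Real.log_le_log (hpos _)
      (ENNReal.toReal_mono (ENNReal.mul_ne_top (hfin m) (hfin n)) (hmul m n))
  have hexp : ∀ n, u n ^ (1 / (n : ℝ)) = ENNReal.ofReal (Real.exp (s n / n)) := fun n => by
    conv_lhs => rw [← ENNReal.ofReal_toReal (hfin n)]
    rw [ENNReal.ofReal_rpow_of_pos (hpos n), Real.rpow_def_of_pos (hpos n), mul_one_div]
  refine ⟨⨅ n : {n : ℕ // n ≠ 0}, u n ^ (1 / ((n : ℕ) : ℝ)),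
    tendsto_order.2 ⟨fun a ha => ?_, fun a ha => ?_⟩⟩
  · filter_upwards [eventually_ne_atTop 0] with n hn
    exact ha.trans_le (iInf_le (fun n : {n : ℕ // n ≠ 0} => u n ^ (1 / ((n : ℕ) : ℝ))) ⟨n, hn⟩)
  · obtain ⟨⟨m, hm⟩, hma⟩ := iInf_lt_iff.1 ha
    obtain ⟨b, hmb, hba⟩ := exists_between hma
    have hb : b ≠ ⊤ := (hba.trans_le le_top).ne
    simp only [hexp] at hmb ⊢
    have hb0 : 0 < b.toReal := ENNReal.toReal_pos (bot_le.trans_lt hmb).ne' hb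
    have hlog : s m / m < Real.log b.toReal := by
      rw [Real.lt_log_iff_exp_lt hb0]
      exact (ENNReal.ofReal_lt_iff_lt_toReal (Real.exp_pos _).le hb).1 hmb
    filter_upwards [hs.eventually_div_lt_of_div_lt hm hlog] with n hn
    refine lt_trans ?_ hba
    rw [ENNReal.ofReal_lt_iff_lt_toReal (Real.exp_pos _).le hb]
    exact (Real.lt_log_iff_exp_lt hb0).1 hn

/-! ### Contraction of powers of a channel -/

lemma IsQuantumFDivergence.div_pow_le {f : ℝ → ℝ} {D : Mat d → Mat d → ℝ≥0∞}
    (hD : IsQuantumFDivergence f D) {E : SuperOp d} (hE : IsChannel E) {π : Mat d}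
    (hπ : IsState π) (hfix : E π = π) {ρ : Mat d} (hρ : IsState ρ) (n : ℕ) :
    D ((E ^ n) ρ) π ≤ D ρ π := by
  induction n with
  | zero => exact le_rfl
  | succ n ih =>
    refine le_trans ?_ ih
    have := hD.dataProcessing E hE _ π (hE.isState_pow hρ n) hπ
    rwa [hfix, ← Module.End.mul_apply, ← pow_succ'] at this

/-- The defining inequality of the SDPI constant for a map that fixes `π`. -/
lemma div_le_sdpi_mul {D : Mat d → Mat d → ℝ≥0∞} {E : SuperOp d} {π : Mat d} (hfix : E π = π)
    {ρ : Mat d} (hρ : IsState ρ) (hle : D ρ π = 0 → D (E ρ) π = 0) (hfin : D ρ π ≠ ⊤) :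
    D (E ρ) π ≤ sdpi D E π * D ρ π := by
  rcases eq_or_ne (D ρ π) 0 with h0 | h0
  · simp [hle h0]
  · rw [← ENNReal.div_le_iff h0 hfin]
    have : D (E ρ) (E π) / D ρ π ≤ sdpi D E π :=
      le_iSup₂_of_le ρ hρ (le_iSup₂_of_le (pos_iff_ne_zero.2 h0) (lt_top_iff_ne_top.2 hfin) le_rfl)
    rwa [hfix] at this

lemma sdpi_pow_le_one {f : ℝ → ℝ} {D : Mat d → Mat d → ℝ≥0∞}
    (hD : IsQuantumFDivergence f D) {E : SuperOp d} (hE : IsChannel E) {π : Mat d}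
    (hπ : IsState π) (hfix : E π = π) (n : ℕ) : sdpi D (E ^ n) π ≤ 1 := by
  refine iSup₂_le fun ρ hρ => iSup₂_le fun _ _ => ?_
  rw [pow_apply_fixed hfix]
  exact ENNReal.div_le_of_le_mul (by rw [one_mul]; exact hD.div_pow_le hE hπ hfix hρ n)

lemma IsQuantumFDivergence.div_pow_le_sdpi_mul {f : ℝ → ℝ} {D : Mat d → Mat d → ℝ≥0∞}
    (hD : IsQuantumFDivergence f D) {E : SuperOp d} (hE : IsChannel E) {π : Mat d}
    (hπ : IsState π) (hfix : E π = π) {ρ : Mat d} (hρ : IsState ρ) (hfin : D ρ π ≠ ⊤) (n : ℕ) :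
    D ((E ^ n) ρ) π ≤ sdpi D (E ^ n) π * D ρ π :=
  div_le_sdpi_mul (pow_apply_fixed hfix n) hρ
    (fun h => le_antisymm ((hD.div_pow_le hE hπ hfix hρ n).trans h.le) bot_le) hfin

lemma sdpi_pow_add_le {f : ℝ → ℝ} {D : Mat d → Mat d → ℝ≥0∞}
    (hD : IsQuantumFDivergence f D) {E : SuperOp d} (hE : IsChannel E) {π : Mat d}
    (hπ : IsState π) (hfix : E π = π) (m n : ℕ) :
    sdpi D (E ^ (m + n)) π ≤ sdpi D (E ^ m) π * sdpi D (E ^ n) π := by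
  refine iSup₂_le fun ρ hρ => iSup₂_le fun _ hfin => ?_
  rw [pow_apply_fixed hfix]
  refine ENNReal.div_le_of_le_mul ?_
  rw [pow_add, Module.End.mul_apply]
  have hfin' : D ((E ^ n) ρ) π ≠ ⊤ := ((hD.div_pow_le hE hπ hfix hρ n).trans_lt hfin).ne
  calc D ((E ^ m) ((E ^ n) ρ)) π
      ≤ sdpi D (E ^ m) π * D ((E ^ n) ρ) π :=
        hD.div_pow_le_sdpi_mul hE hπ hfix (hE.isState_pow hρ n) hfin' m
    _ ≤ sdpi D (E ^ m) π * (sdpi D (E ^ n) π * D ρ π) := by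
        gcongr
        exact hD.div_pow_le_sdpi_mul hE hπ hfix hρ hfin.ne n
    _ = _ := (mul_assoc _ _ _).symm

lemma chiSq_self (g : ℝ → ℝ) (σ : Mat d) : chiSq g σ σ = 0 := by
  rw [chiSq_eq, sub_self, chiForm_zero, ENNReal.ofReal_zero]

lemma chiSq_ne_top (g : ℝ → ℝ) (ρ σ : Mat d) : chiSq g ρ σ ≠ ⊤ := ENNReal.ofReal_ne_top

lemma chiSq_eq_zero_iff {g : ℝ → ℝ} (hg : MemMst g) {ρ σ : Mat d} (hσ : σ.PosDef) :
    chiSq g ρ σ = 0 ↔ ρ = σ := by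
  refine ⟨fun h => ?_, fun h => h ▸ chiSq_self g ρ⟩
  by_contra hne
  have := chiForm_pos hg hσ (sub_ne_zero.2 hne)
  rw [chiSq_eq, ENNReal.ofReal_eq_zero] at h
  linarith

lemma chiSq_pow_le {g : ℝ → ℝ} (hg : MemMst g) {E : SuperOp d} (hE : IsChannel E) {π : Mat d}
    (hπpos : π.PosDef) (hfix : E π = π) {ρ : Mat d} (hρ : IsState ρ) (n : ℕ) :
    chiSq g ((E ^ n) ρ) π ≤ sdpi (chiSq g) E π ^ n * chiSq g ρ π := by
  induction n with
  | zero => simp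
  | succ n ih =>
    rw [pow_succ', Module.End.mul_apply]
    have h : chiSq g (E ((E ^ n) ρ)) π ≤ sdpi (chiSq g) E π * chiSq g ((E ^ n) ρ) π := by
      refine div_le_sdpi_mul hfix (hE.isState_pow hρ n) (fun h0 => ?_) (chiSq_ne_top _ _ _)
      rw [(chiSq_eq_zero_iff hg hπpos).1 h0, hfix, chiSq_self]
    refine h.trans ?_
    rw [pow_succ', mul_assoc]
    gcongr

/-- The Pinsker inequality bounds `χ²_g` by a multiple of the divergence. -/
lemma exists_chiSq_le_div {f g : ℝ → ℝ} (hf : MemFPin f) {D : Mat d → Mat d → ℝ≥0∞}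
    (hD : IsQuantumFDivergence f D) {π : Mat d} (hπ : IsState π) :
    ∃ K : ℝ, 0 < K ∧ ∀ ρ, IsState ρ → chiSq g ρ π ≤ ENNReal.ofReal K * D ρ π := by
  obtain ⟨c, hc, h⟩ := exists_hsSq_le_div hf hD hπ
  obtain ⟨K, hK, hle⟩ := exists_forall_le_mul (continuous_chiForm g π) continuous_hsSq
    (fun X t => chiForm_smul g π X t) (fun X t => hsSq_smul X t) fun X hX => hsSq_pos hX
  refine ⟨K / c, by positivity, fun ρ hρ => ?_⟩
  calc chiSq g ρ π ≤ ENNReal.ofReal (K / c * (c * hsSq (ρ - π))) := by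
        rw [chiSq_eq]
        refine ENNReal.ofReal_le_ofReal ((hle _).trans (le_of_eq ?_))
        field_simp
    _ = ENNReal.ofReal (K / c) * ENNReal.ofReal (c * hsSq (ρ - π)) :=
        ENNReal.ofReal_mul (by positivity)
    _ ≤ _ := by gcongr; exact h ρ hρ

/-- After enough steps a primitive channel sends all states above a fixed multiple of `π`, where
the divergence is bounded by a multiple of `χ²_g`. -/
lemma exists_div_pow_le_chiSq {f g : ℝ → ℝ} (hf : MemF f) (hg : MemMst g)
    {D : Mat d → Mat d → ℝ≥0∞} (hD : IsQuantumFDivergence f D) {E : SuperOp d} (hE : IsChannel E)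
    (hprim : IsPrimitive E) {π : Mat d} (hπ : IsState π) (hπpos : π.PosDef) :
    ∃ (K : ℝ) (n₀ : ℕ), 0 < K ∧ ∀ n ≥ n₀, ∀ ρ, IsState ρ →
      D ((E ^ n) ρ) π ≤ ENNReal.ofReal K * chiSq g ((E ^ n) ρ) π := by
  obtain ⟨n₀, hn₀⟩ := hprim
  obtain ⟨b, hb, hle⟩ := exists_forall_posSemidef_sub (F := E ^ n₀) (G := fun _ => π)
    (continuous_superOp _) continuous_const hn₀ (fun _ _ => hπ.1.isHermitian)
  obtain ⟨K₁, hK₁, h₁⟩ := exists_div_le_hsSq hf hD hπ hπpos (inv_pos.2 hb)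
  obtain ⟨K₂, hK₂, h₂⟩ := exists_forall_le_mul continuous_hsSq (continuous_chiForm g π)
    (fun X t => hsSq_smul X t) (fun X t => chiForm_smul g π X t)
    fun X hX => chiForm_pos hg hπpos hX
  refine ⟨K₁ * K₂, n₀, by positivity, fun n hn ρ hρ => ?_⟩
  obtain ⟨k, rfl⟩ := Nat.exists_eq_add_of_le hn
  have hpsd : ((E ^ (n₀ + k)) ρ - b⁻¹ • π).PosSemidef := by
    have := (hle _ (hE.isState_pow hρ k)).smul (inv_nonneg.2 hb.le)
    rwa [smul_sub, smul_smul, inv_mul_cancel₀ hb.ne', one_smul, ← Module.End.mul_apply,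
      ← pow_add] at this
  refine (h₁ _ (hE.isState_pow hρ _) hpsd).trans ?_
  rw [chiSq_eq, ← ENNReal.ofReal_mul (by positivity), mul_assoc]
  exact ENNReal.ofReal_le_ofReal (mul_le_mul_of_nonneg_left (h₂ _) hK₁.le)

lemma le_of_tendsto_rpow_of_le_mul_pow {u : ℕ → ℝ≥0∞} {L η : ℝ≥0∞} {K : ℝ} (hK : 0 < K) {n₀ : ℕ}
    (hu : Tendsto (fun n : ℕ => u n ^ (1 / (n : ℝ))) atTop (𝓝 L))
    (h : ∀ n ≥ n₀, u n ≤ ENNReal.ofReal K * η ^ n) : L ≤ η := by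
  have hKlim : Tendsto (fun n : ℕ => ENNReal.ofReal (K ^ (1 / (n : ℝ)))) atTop (𝓝 1) := by
    have : Tendsto (fun n : ℕ => K ^ (1 / (n : ℝ))) atTop (𝓝 (K ^ (0 : ℝ))) :=
      tendsto_const_nhds.rpow tendsto_one_div_atTop_nhds_zero_nat (Or.inl hK.ne')
    rw [Real.rpow_zero] at this
    simpa using ENNReal.tendsto_ofReal this
  have hlim : Tendsto (fun n : ℕ => ENNReal.ofReal (K ^ (1 / (n : ℝ))) * η) atTop (𝓝 η) := by
    simpa using ENNReal.Tendsto.mul_const hKlim (Or.inl one_ne_zero) (b := η)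
  refine le_of_tendsto_of_tendsto hu hlim ?_
  filter_upwards [eventually_ge_atTop n₀, eventually_ne_atTop 0] with n hn hn0
  calc u n ^ (1 / (n : ℝ)) ≤ (ENNReal.ofReal K * η ^ n) ^ (1 / (n : ℝ)) :=
        ENNReal.rpow_le_rpow (h n hn) (by positivity)
    _ = ENNReal.ofReal (K ^ (1 / (n : ℝ))) * η := by
        rw [ENNReal.mul_rpow_of_nonneg _ _ (by positivity), ENNReal.ofReal_rpow_of_pos hK,
          ← ENNReal.rpow_natCast, ← ENNReal.rpow_mul,
          mul_one_div_cancel (Nat.cast_ne_zero.2 hn0), ENNReal.rpow_one]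

lemma sdpi_pow_le_mul_pow {f g : ℝ → ℝ} (hf : MemFPin f) (hg : MemMst g)
    {D : Mat d → Mat d → ℝ≥0∞} (hD : IsQuantumFDivergence f D) {E : SuperOp d} (hE : IsChannel E)
    (hprim : IsPrimitive E) {π : Mat d} (hπ : IsState π) (hπpos : π.PosDef) (hfix : E π = π) :
    ∃ (K : ℝ) (n₀ : ℕ), 0 < K ∧ ∀ n ≥ n₀,
      sdpi D (E ^ n) π ≤ ENNReal.ofReal K * sdpi (chiSq g) E π ^ n := by
  obtain ⟨K₁, n₀, hK₁, h₁⟩ := exists_div_pow_le_chiSq hf.memF hg hD hE hprim hπ hπpos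
  obtain ⟨K₂, hK₂, h₂⟩ := exists_chiSq_le_div (g := g) hf hD hπ
  refine ⟨K₁ * K₂, n₀, by positivity, fun n hn => ?_⟩
  refine iSup₂_le fun ρ hρ => iSup₂_le fun _ _ => ENNReal.div_le_of_le_mul ?_
  rw [pow_apply_fixed hfix, ENNReal.ofReal_mul hK₁.le]
  calc D ((E ^ n) ρ) π ≤ ENNReal.ofReal K₁ * chiSq g ((E ^ n) ρ) π := h₁ n hn ρ hρ
    _ ≤ ENNReal.ofReal K₁ * (sdpi (chiSq g) E π ^ n * (ENNReal.ofReal K₂ * D ρ π)) := by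
        gcongr
        refine (chiSq_pow_le hg hE hπpos hfix hρ n).trans ?_
        gcongr
        exact h₂ ρ hρ
    _ = _ := by ring

/-! ### The local behaviour of the divergence -/

lemma chiSq_convexComb (g : ℝ → ℝ) (ρ π : Mat d) (t : ℝ) :
    chiSq g ((t : ℂ) • ρ + ((1 - t : ℝ) : ℂ) • π) π =
      ENNReal.ofReal (t ^ 2) * chiSq g ρ π := by
  have : (t : ℂ) • ρ + ((1 - t : ℝ) : ℂ) • π - π = t • (ρ - π) := by
    have ht : t • (ρ - π) = (t : ℂ) • (ρ - π) := by ext; simp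
    rw [ht]
    push_cast
    module
  rw [chiSq_eq, this, chiForm_smul, ENNReal.ofReal_mul (sq_nonneg t), chiSq_eq]

lemma map_convexComb {F : SuperOp d} {π : Mat d} (hF : F π = π) (ρ : Mat d) (t : ℝ) :
    F ((t : ℂ) • ρ + ((1 - t : ℝ) : ℂ) • π) = (t : ℂ) • F ρ + ((1 - t : ℝ) : ℂ) • π := by
  rw [map_add, map_smul, map_smul, hF]

lemma posDef_convexComb {ρ π : Mat d} (hρ : ρ.PosSemidef) (hπ : π.PosDef) {t : ℝ}
    (h0 : 0 ≤ t) (h1 : t < 1) : ((t : ℂ) • ρ + ((1 - t : ℝ) : ℂ) • π).PosDef :=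
  PosDef.posSemidef_add (hρ.smul (by exact_mod_cast h0))
    (hπ.smul (by exact_mod_cast sub_pos.2 h1))

/-- For states near `π` the divergence is `χ²_g` up to a constant, so its SDPI constants dominate
the contraction ratios of `χ²_g`. -/
lemma chiSq_pow_le_sdpi_mul {f g : ℝ → ℝ} (hf : MemFPin f) (hg : MemMst g)
    {D : Mat d → Mat d → ℝ≥0∞} (hD : IsQuantumFDivergence f D) {E : SuperOp d} (hE : IsChannel E)
    {π : Mat d} (hπ : IsState π) (hπpos : π.PosDef) (hfix : E π = π)
    (hloc : IsLocallyChiSq f g D) {ρ : Mat d} (hρ : IsState ρ) (n : ℕ) :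
    chiSq g ((E ^ n) ρ) π ≤ sdpi D (E ^ n) π * chiSq g ρ π := by
  have hfixn := pow_apply_fixed hfix n
  -- it suffices to treat full-rank states, as both sides scale alike along the segment from `π`
  suffices key : ∀ ρ, IsState ρ → ρ.PosDef → ((E ^ n) ρ).PosDef →
      chiSq g ((E ^ n) ρ) π ≤ sdpi D (E ^ n) π * chiSq g ρ π by
    have h0 : (0 : ℝ) ≤ 1 / 2 := by norm_num
    have h1 : (1 / 2 : ℝ) < 1 := by norm_num
    have hEρ := hE.isState_pow hρ n
    have := key _ (hρ.convexComb hπ h0 h1.le) (posDef_convexComb hρ.1 hπpos h0 h1)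
      (by rw [map_convexComb hfixn]; exact posDef_convexComb hEρ.1 hπpos h0 h1)
    rw [map_convexComb hfixn, chiSq_convexComb, chiSq_convexComb, mul_left_comm] at this
    exact (ENNReal.mul_le_mul_iff_right (by simp) ENNReal.ofReal_ne_top).1 this
  intro ρ hρ hρpos hEρpos
  rcases eq_or_ne ρ π with rfl | hne
  · rw [hfixn, chiSq_self]; exact bot_le
  obtain ⟨K, hK, hKD⟩ := exists_chiSq_le_div (g := g) hf hD hπ
  have hχ : chiSq g ρ π ≠ 0 := fun h => hne ((chiSq_eq_zero_iff hg hπpos).1 h)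
  have hlim := hloc ρ π hρ hπ hρpos hπpos
  have hlimE := hloc _ π (hE.isState_pow hρ n) hπ hEρpos hπpos
  set c : ℝ≥0∞ := ENNReal.ofReal (deriv (deriv f) 1 / 2) with hc
  have hsmall : ∀ᶠ t : ℝ in 𝓝[>] 0, 0 < t ∧ t < 1 :=
    Ioo_mem_nhdsGT (by norm_num : (0 : ℝ) < 1)
  -- the Pinsker inequality keeps the local constant away from `0`
  have hc0 : c ≠ 0 := by
    intro h0
    have hle : chiSq g ρ π ≤ ENNReal.ofReal K * (c * chiSq g ρ π) := by
      refine le_of_tendsto_of_tendsto tendsto_const_nhds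
        (ENNReal.Tendsto.const_mul hlim (Or.inr ENNReal.ofReal_ne_top)) ?_
      filter_upwards [hsmall] with t ht
      have := hKD _ (hρ.convexComb hπ ht.1.le ht.2.le)
      have ht0 : ENNReal.ofReal (t ^ 2) ≠ 0 := by
        rw [Ne, ENNReal.ofReal_eq_zero, not_le]; exact pow_pos ht.1 2
      rw [chiSq_convexComb] at this
      rw [← mul_div_assoc, ENNReal.le_div_iff_mul_le (Or.inl ht0) (Or.inl ENNReal.ofReal_ne_top),
        mul_comm]
      exact this
    rw [h0, zero_mul, mul_zero] at hle
    exact hχ (le_antisymm hle bot_le)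
  have hfinlim : c * chiSq g ρ π < ⊤ :=
    (ENNReal.mul_ne_top ENNReal.ofReal_ne_top (chiSq_ne_top _ _ _)).lt_top
  have hη : sdpi D (E ^ n) π ≠ ⊤ :=
    ((sdpi_pow_le_one hD hE hπ hfix n).trans_lt ENNReal.one_lt_top).ne
  have hle : c * chiSq g ((E ^ n) ρ) π ≤ sdpi D (E ^ n) π * (c * chiSq g ρ π) := by
    refine le_of_tendsto_of_tendsto hlimE (ENNReal.Tendsto.const_mul hlim (Or.inr hη)) ?_
    filter_upwards [hsmall, hlim.eventually (gt_mem_nhds hfinlim)] with t ht hfin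
    have hfin' : D ((t : ℂ) • ρ + ((1 - t : ℝ) : ℂ) • π) π ≠ ⊤ := by
      intro htop
      rw [htop, ENNReal.top_div_of_ne_top ENNReal.ofReal_ne_top] at hfin
      exact lt_irrefl _ hfin
    have := hD.div_pow_le_sdpi_mul hE hπ hfix (hρ.convexComb hπ ht.1.le ht.2.le) hfin' n
    rw [map_convexComb hfixn] at this
    rw [← mul_div_assoc]
    gcongr
  rw [mul_left_comm] at hle
  exact (ENNReal.mul_le_mul_iff_right hc0 ENNReal.ofReal_ne_top).1 hle

/-- Under detailed balance the contraction ratio of `χ²_g` over `n` steps is at least the `n`-th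
power of that over one step, state by state. -/
lemma sdpi_chiSq_pow_le {f g : ℝ → ℝ} (hf : MemFPin f) (hg : MemMst g)
    {D : Mat d → Mat d → ℝ≥0∞} (hD : IsQuantumFDivergence f D) {E : SuperOp d} (hE : IsChannel E)
    {π : Mat d} (hπ : IsState π) (hπpos : π.PosDef) (hfix : E π = π)
    (hloc : IsLocallyChiSq f g D) (hdb : DetailedBalance g π E) {ρ : Mat d} (hρ : IsState ρ)
    (hne : ρ ≠ π) (n : ℕ) :
    (chiSq g (E ρ) π / chiSq g ρ π) ^ n ≤ sdpi D (E ^ n) π := by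
  have hX := sub_ne_zero.2 hne
  have hpos := chiForm_pos hg hπpos hX
  have hsub : ∀ n, (E ^ n) ρ - π = (E ^ n) (ρ - π) := fun n => by
    rw [map_sub, pow_apply_fixed hfix]
  have hratio : ∀ n, chiSq g ((E ^ n) ρ) π / chiSq g ρ π =
      ENNReal.ofReal (chiForm g π ((E ^ n) (ρ - π)) / chiForm g π (ρ - π)) := fun n => by
    rw [chiSq_eq, chiSq_eq, hsub, ENNReal.ofReal_div_of_pos hpos]
  calc (chiSq g (E ρ) π / chiSq g ρ π) ^ n
      = ENNReal.ofReal ((chiForm g π (E (ρ - π)) / chiForm g π (ρ - π)) ^ n) := by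
        have := hratio 1
        rw [pow_one] at this
        rw [this, ENNReal.ofReal_pow (div_nonneg (chiForm_nonneg hg hπpos _) hpos.le)]
    _ ≤ chiSq g ((E ^ n) ρ) π / chiSq g ρ π := by
        rw [hratio]
        exact ENNReal.ofReal_le_ofReal (pow_chiForm_le hg hπpos hdb hX n)
    _ ≤ sdpi D (E ^ n) π :=
        ENNReal.div_le_of_le_mul (chiSq_pow_le_sdpi_mul hf hg hD hE hπ hπpos hfix hloc hρ n)

end QDiv

end

theorem theorem1 {d : ℕ} (f g : ℝ → ℝ) (hf : QDiv.MemFPin f)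
    (hf3 : ∃ ε : ℝ, 0 < ε ∧ ContDiffOn ℝ 3 f (Set.Ioo (1 - ε) (1 + ε)))
    (hg : QDiv.MemMst g)
    (E : QDiv.SuperOp d) (hE : QDiv.IsChannel E) (hprim : QDiv.IsPrimitive E)
    (π : QDiv.Mat d) (hπ : QDiv.IsState π) (hπpos : π.PosDef) (hfix : E π = π)
    (D : QDiv.Mat d → QDiv.Mat d → ℝ≥0∞) (hD : QDiv.IsQuantumFDivergence f D) :
    ∃ L : ℝ≥0∞,
      Filter.Tendsto (fun n : ℕ => QDiv.sdpi D (E ^ n) π ^ (1 / (n : ℝ))) Filter.atTop (𝓝 L) ∧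
      L ≤ QDiv.sdpi (QDiv.chiSq g) E π ∧
      (QDiv.IsLocallyChiSq f g D → QDiv.DetailedBalance g π E →
        L = QDiv.sdpi (QDiv.chiSq g) E π) := by
  obtain ⟨L, hL⟩ := QDiv.exists_tendsto_rpow_of_submultiplicative
    (QDiv.sdpi_pow_le_one hD hE hπ hfix) (QDiv.sdpi_pow_add_le hD hE hπ hfix)
  obtain ⟨K, n₀, hK, hle⟩ := QDiv.sdpi_pow_le_mul_pow hf hg hD hE hprim hπ hπpos hfix
  have hLle := QDiv.le_of_tendsto_rpow_of_le_mul_pow hK hL hle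
  refine ⟨L, hL, hLle, fun hloc hdb => le_antisymm hLle ?_⟩
  refine iSup₂_le fun ρ hρ => iSup₂_le fun hpos _ => ?_
  rw [hfix]
  refine ge_of_tendsto hL ?_
  filter_upwards [Filter.eventually_ne_atTop 0] with n hn
  have hne : ρ ≠ π := fun h => hpos.ne' ((QDiv.chiSq_eq_zero_iff hg hπpos).2 h)
  have := QDiv.sdpi_chiSq_pow_le hf hg hD hE hπ hπpos hfix hloc hdb hρ hne n
  calc QDiv.chiSq g (E ρ) π / QDiv.chiSq g ρ π
      = ((QDiv.chiSq g (E ρ) π / QDiv.chiSq g ρ π) ^ n) ^ (1 / (n : ℝ)) := by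
        rw [← ENNReal.rpow_natCast, ← ENNReal.rpow_mul,
          mul_one_div_cancel (Nat.cast_ne_zero.2 hn), ENNReal.rpow_one]
    _ ≤ _ := ENNReal.rpow_le_rpow this (by positivity)
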